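/- Let $p$ be a prime, $k$ an arbitrary field of characteristic $p$, $E=k((t))$ with $t$-adic valuation $v$, and $G_E=\mathrm{Gal}(E^{\mathrm{sep}}/E)$. For a discrete abelian group $A$ put $H^1(G_E,A)=\mathrm{Hom}^{\mathrm{cont}}(G_E,A)$. Notation. For a commutative ring $R$, $W_m(R)$ denotes the $p$-typical Witt vectors $(\lambda_0,\dots,\lambda_m)$ of length $m+1$; $V$ is the Verschiebung; if $pR=0$, $\bar F(\lambda_0,\dots,\lambda_m)=(\lambda_0^p,\dots,\lambda_m^p)$. Put $CW(R)=\varinjlim(W_m(R)\xrightarrow{V}W_{m+1}(R)\to\cdots)$ and, if $pR=0$, $\widetilde{CW}(R)=\varinjlim(W_m(R)\xrightarrow{V\bar F}W_{m+1}(R)\to\cdots)$, with $\mathrm{Fil}_m(\widetilde{CW}(R))$ the image of $W_m(R)$. Let $J_p=\{n\ge 1: (n,p)=1\}$. For $n\in J_p$, $d=np^m$ and $\lambda\in W_m(k)$ let $\lambda t^{-d}\in CW(E)$ be the class of $(\lambda_0t^{-n},\lambda_1t^{-np},\dots,\lambda_mt^{-np^m})$. For $\lambda\in W_m(E)$ let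 $v(\lambda)=\min_i p^{m-i}v(\lambda_i)$, and for $d\ge 0$ let $\mathrm{Fil}_d(CW(E))$ be the union over $m$ of the images of $\{\lambda\in W_m(E): v(\lambda)\ge -d\}$. Let $\delta:CW(E)\to H^1(G_E,\mathbb{Q}_p/\mathbb{Z}_p)$ be the Artin–Schreier–Witt morphism: for $\lambda\in W_m(E)$, $\delta(\lambda)(\gamma)=a/p^{m+1}$, where $\nu\in W_m(E^{\mathrm{sep}})$ satisfies $\bar F(\nu)-\nu=\lambda$ and $\gamma(\nu)-\nu=a\in\mathbb{Z}/p^{m+1}\mathbb{Z}=W_m(\mathbb{F}_p)$. Kato's filtration is $\mathrm{Fil}_d(H^1(G_E,\mathbb{Q}_p/\mathbb{Z}_p))=\delta(\mathrm{Fil}_d(CW(E)))$, and $\mathrm{Fil}_d(H^1(G_E,\mathbb{Q}/\mathbb{Z}))$ is its inverse image under the map induced by the projection $\mathbb{Q}/\mathbb{Z}=\bigoplus_\ell\mathbb{Q}_\ell/\mathbb{Z}_\ell\to\mathbb{Q}_p/\mathbb{Z}_p$. For each of these filtrations on $CW(E)$ and on $H^1$, $\mathrm{Fil}_{-1}=0$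 and $\mathrm{Gr}_d=\mathrm{Fil}_d/\mathrm{Fil}_{d-1}$. Theorem. (1) $\delta$ is well defined and induces the first of the isomorphisms $$H^1(G_E,\mathbb{Q}_p/\mathbb{Z}_p)\;\cong\;\frac{CW(E)}{(\bar F-1)CW(E)}\;\cong\;\Bigl(\bigoplus_{n\in J_p}\widetilde{CW}(k)\Bigr)\oplus\frac{CW(k)}{(\bar F-1)CW(k)};$$ the second sends the class of $\lambda t^{-np^m}$, for $n\in J_p$ and $\lambda\in W_m(k)$, to the class of $\lambda$ in the $n$-th copy of $\widetilde{CW}(k)$, and the class of $f_0\in CW(k)\subset CW(E)$ to the class of $f_0$ in the last summand. (2) The maps $W_m(k)\to\mathrm{Fil}_m(\widetilde{CW}(k))$ are isomorphisms. Under (1), $\mathrm{Fil}_0(H^1(G_E,\mathbb{Q}_p/\mathbb{Z}_p))=CW(k)/(\bar F-1)CW(k)$ and, for $d\ge 1$, $$\mathrm{Fil}_d(H^1(G_E,\mathbb{Q}_p/\mathbb{Z}_p))=\Bigl(\bigoplus_{n\in J_p,\ n\le d}\mathrm{Fil}_{m_{n,d}}(\widetilde{CW}(k))\Bigr)\oplus\frac{CW(k)}{(\bar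 F-1)CW(k)},\qquad m_{n,d}=\max\{m\ge 0: np^m\le d\}.$$ Moreover $\mathrm{Gr}_d(H^1(G_E,\mathbb{Q}_p/\mathbb{Z}_p))\cong W_{v_p(d)}(k)/pW_{v_p(d)}(k)$ for $d>0$, and $\mathrm{Gr}_0(H^1(G_E,\mathbb{Q}_p/\mathbb{Z}_p))\cong CW(k)/(\bar F-1)CW(k)$. (3) For each $d\ge 0$ the map $\delta$ induces an epimorphism $\mathrm{Proj}_d:\mathrm{Gr}_d(CW(E))\to\mathrm{Gr}_d(H^1(G_E,\mathbb{Q}_p/\mathbb{Z}_p))$. For $d>0$, $\lambda\mapsto\lambda t^{-d}$ induces an isomorphism $W_{v_p(d)}(k)\cong\mathrm{Gr}_d(CW(E))$, and the inclusion $k[[t]]\subset E$ induces an isomorphism $CW(k[[t]])\cong\mathrm{Gr}_0(CW(E))$. Via these isomorphisms and those of (2), $\mathrm{Proj}_d$ is the canonical projection $W_{v_p(d)}(k)\to W_{v_p(d)}(k)/pW_{v_p(d)}(k)$ for $d>0$, and $\mathrm{Proj}_0$ is the map $CW(k[[t]])\xrightarrow{t\mapsto 0}CW(k)\to CW(k)/(\bar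 F-1)CW(k)$. (4) For every $d\ge 0$, the projections $\mathbb{Q}/\mathbb{Z}\to\mathbb{Q}_\ell/\mathbb{Z}_\ell$ induce an isomorphism $$\mathrm{Fil}_d(H^1(G_E,\mathbb{Q}/\mathbb{Z}))\cong\mathrm{Fil}_d(H^1(G_E,\mathbb{Q}_p/\mathbb{Z}_p))\oplus\bigoplus_{\ell\ne p}H^1(G_E,\mathbb{Q}_\ell/\mathbb{Z}_\ell).$$ They induce isomorphisms $\mathrm{Gr}_d(H^1(G_E,\mathbb{Q}/\mathbb{Z}))\cong\mathrm{Gr}_d(H^1(G_E,\mathbb{Q}_p/\mathbb{Z}_p))$ for $d>0$, and $\mathrm{Gr}_0(H^1(G_E,\mathbb{Q}/\mathbb{Z}))\cong\mathrm{Fil}_0(H^1(G_E,\mathbb{Q}_p/\mathbb{Z}_p))\oplus\bigoplus_{\ell\ne p}H^1(G_E,\mathbb{Q}_\ell/\mathbb{Z}_\ell)$. -/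

import Mathlib

open scoped DirectSum

noncomputable section

namespace KatoSwan

/-! ### Truncated Witt vectors and Witt covectors -/

/-- `W p m R` is the ring of Witt vectors `(λ₀, …, λₘ)` of length `m + 1`. -/
abbrev W (p m : ℕ) (R : Type*) : Type _ := TruncatedWittVector p (m + 1) R

section Witt

variable (p : ℕ) [hp : Fact p.Prime]

/-- The ring homomorphism of truncated Witt vectors induced by a ring homomorphism. -/
def W.map {R S : Type*} [CommRing R] [CommRing S] (m : ℕ) (f : R →+* S) : W p m R →+* W p m S :=
  have key (x : WittVector p R) :
      (TruncatedWittVector.mk p fun i =>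
          f ((WittVector.truncate (m + 1) x : W p m R).coeff i) : W p m S) =
        WittVector.truncate (m + 1) (WittVector.map f x) := by
    ext i
    simp [TruncatedWittVector.coeff_mk, WittVector.coeff_truncate]
  { toFun := fun x => TruncatedWittVector.mk p fun i => f (x.coeff i)
    map_one' := by
      have := key 1
      simpa using this
    map_zero' := by
      have := key 0
      simpa using this
    map_mul' := fun x y => by
      obtain ⟨x, rfl⟩ := WittVector.truncate_surjective p (m + 1) R x
      obtain ⟨y, rfl⟩ := WittVector.truncate_surjective p (m + 1) R y
      rw [← map_mul, key, key, key, map_mul, map_mul]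
    map_add' := fun x y => by
      obtain ⟨x, rfl⟩ := WittVector.truncate_surjective p (m + 1) R x
      obtain ⟨y, rfl⟩ := WittVector.truncate_surjective p (m + 1) R y
      rw [← map_add, key, key, key, map_add, map_add] }

/-- The `(j - i)`-fold Verschiebung
`(λ₀, …, λᵢ) ↦ (0, …, 0, λ₀, …, λᵢ) : W p i R → W p j R`. -/
def W.shift (R : Type*) [CommRing R] (i j : ℕ) (h : i ≤ j) : W p i R →+ W p j R :=
  have key (x : WittVector p R) :
      (TruncatedWittVector.mk p fun l : Fin (j + 1) =>
          if (l : ℕ) < j - i then 0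
          else (WittVector.truncate (i + 1) x : W p i R).coeff ⟨l - (j - i), by omega⟩ : W p j R) =
        WittVector.truncate (j + 1) (WittVector.verschiebung^[j - i] x) := by
    ext l
    rw [TruncatedWittVector.coeff_mk, WittVector.coeff_truncate (n := j + 1)]
    split_ifs with hl
    · rw [WittVector.iterate_verschiebung_coeff_eq_zero _ hl]
    · rw [WittVector.coeff_truncate]
      have hc : (l : ℕ) = (l - (j - i)) + (j - i) := by omega
      conv_rhs => rw [hc, WittVector.iterate_verschiebung_coeff]
  { toFun := fun x => TruncatedWittVector.mk p fun l : Fin (j + 1) =>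
      if (l : ℕ) < j - i then 0 else x.coeff ⟨l - (j - i), by omega⟩
    map_zero' := by
      have := key 0
      rw [map_zero] at this
      rw [this, iterate_map_zero, map_zero]
    map_add' := fun x y => by
      obtain ⟨x, rfl⟩ := WittVector.truncate_surjective p (i + 1) R x
      obtain ⟨y, rfl⟩ := WittVector.truncate_surjective p (i + 1) R y
      rw [← map_add, key, key, key, iterate_map_add, map_add] }

theorem W.coeff_map {R S : Type*} [CommRing R] [CommRing S] (m : ℕ) (f : R →+* S) (x : W p m R)
    (i : Fin (m + 1)) : (W.map p m f x).coeff i = f (x.coeff i) := rfl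

theorem W.coeff_shift (R : Type*) [CommRing R] (i j : ℕ) (h : i ≤ j) (x : W p i R)
    (l : Fin (j + 1)) : (W.shift p R i j h x).coeff l =
      if (l : ℕ) < j - i then 0 else x.coeff ⟨l - (j - i), by omega⟩ := rfl

theorem W.map_shift {R S : Type*} [CommRing R] [CommRing S] (i j : ℕ) (h : i ≤ j) (f : R →+* S)
    (x : W p i R) : W.map p j f (W.shift p R i j h x) = W.shift p S i j h (W.map p i f x) := by
  ext l
  rw [W.coeff_map, W.coeff_shift, W.coeff_shift]
  split_ifs
  · exact map_zero f
  · rfl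

/-- The Frobenius `(λ₀, …, λₘ) ↦ (λ₀ᵖ, …, λₘᵖ)` in characteristic `p`. -/
def W.frob (R : Type*) [CommRing R] [CharP R p] (m : ℕ) : W p m R →+* W p m R :=
  W.map p m (frobenius R p)

/-- The `(j - i)`-fold iterate of `VF : (λ₀, …, λₘ) ↦ (0, λ₀ᵖ, …, λₘᵖ)`, in characteristic `p`. -/
def W.shiftFrob (R : Type*) [CommRing R] [CharP R p] (i j : ℕ) (h : i ≤ j) : W p i R →+ W p j R :=
  (W.shift p R i j h).comp (W.map p i (iterateFrobenius R p (j - i)) : W p i R →+ W p i R)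

/-- Witt covectors: the direct limit of the groups `W p m R` along the Verschiebung. -/
abbrev CW (R : Type*) [CommRing R] : Type _ :=
  AddCommGroup.DirectLimit (fun m : ℕ => W p m R) (W.shift p R)

/-- The canonical map `W p m R → CW p R`,
`(λ₀, …, λₘ) ↦ (…, 0, 0, λ₀, …, λₘ)`. -/
def CW.of (R : Type*) [CommRing R] (m : ℕ) : W p m R →+ CW p R :=
  AddCommGroup.DirectLimit.of (fun m : ℕ => W p m R) (W.shift p R) m

theorem CW.of_shift (R : Type*) [CommRing R] (i j : ℕ) (h : i ≤ j) (x : W p i R) :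
    CW.of p R j (W.shift p R i j h x) = CW.of p R i x :=
  AddCommGroup.DirectLimit.of_f (G := fun m : ℕ => W p m R) (f := W.shift p R) h x

/-- The homomorphism of covectors induced by a ring homomorphism. -/
def CW.map {R S : Type*} [CommRing R] [CommRing S] (f : R →+* S) : CW p R →+ CW p S :=
  AddCommGroup.DirectLimit.lift (fun m : ℕ => W p m R) (W.shift p R) (CW p S)
    (fun m => (CW.of p S m).comp (W.map p m f : W p m R →+ W p m S))
    (fun i j hij x => by
      change CW.of p S j (W.map p j f (W.shift p R i j hij x)) = CW.of p S i (W.map p i f x)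
      rw [W.map_shift, CW.of_shift])

/-- The Frobenius of the group of covectors, in characteristic `p`. -/
def CW.frob (R : Type*) [CommRing R] [CharP R p] : CW p R →+ CW p R := CW.map p (frobenius R p)

/-- The subgroup `(F - 1) CW(R)` of `CW(R)`. -/
def CW.asw (R : Type*) [CommRing R] [CharP R p] : AddSubgroup (CW p R) :=
  (CW.frob p R - AddMonoidHom.id _).range

/-- The group `CW~(R)`: the direct limit of the groups `W p m R` along the maps
`p = VF : W p m R → W p (m + 1) R`, in characteristic `p`. -/
abbrev CWt (R : Type*) [CommRing R] [CharP R p] : Type _ :=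
  AddCommGroup.DirectLimit (fun m : ℕ => W p m R) (W.shiftFrob p R)

/-- The canonical map from `W p m R` to `CW~(R)`. -/
def CWt.of (R : Type*) [CommRing R] [CharP R p] (m : ℕ) : W p m R →+ CWt p R :=
  AddCommGroup.DirectLimit.of (fun m : ℕ => W p m R) (W.shiftFrob p R) m

/-- The canonical filtration of `CW~(R)`: the image of `W p m R`. -/
def CWt.fil (R : Type*) [CommRing R] [CharP R p] (m : ℕ) : AddSubgroup (CWt p R) :=
  (CWt.of p R m).range

end Witt

/-! ### Characters -/

/-- `H¹(G, A) = Hom^cont(G, A)` for a discrete group `A` with trivial action of `G`. -/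
def H1 (G : Type*) [Group G] [TopologicalSpace G] (A : Type*) [AddCommGroup A] :
    AddSubgroup (Additive G →+ A) where
  carrier := {χ | IsLocallyConstant fun g : G => χ (Additive.ofMul g)}
  zero_mem' := IsLocallyConstant.const 0
  add_mem' := fun h h' => IsLocallyConstant.add h h'
  neg_mem' := fun h => IsLocallyConstant.neg h

/-- The map `H¹(G, A) → H¹(G, B)` induced by a homomorphism `A → B`. -/
def H1.map (G : Type*) [Group G] [TopologicalSpace G] {A B : Type*} [AddCommGroup A]
    [AddCommGroup B] (φ : A →+ B) : H1 G A →+ H1 G B where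
  toFun := fun χ => ⟨φ.comp χ.1, IsLocallyConstant.comp χ.2 φ⟩
  map_zero' := by ext; simp
  map_add' := fun χ χ' => by ext; simp

/-- `ℚ_p / ℤ_p`. -/
abbrev QpZp (p : ℕ) [Fact p.Prime] : Type := ℚ_[p] ⧸ (PadicInt.subring p).toAddSubgroup

/-- `ℚ / ℤ`. -/
abbrev QZ : Type := ℚ ⧸ AddSubgroup.zmultiples (1 : ℚ)

/-- The projection of `ℚ / ℤ = ⨁ ℚ_ℓ / ℤ_ℓ` on its `p`-component, induced by `ℚ ⊆ ℚ_p`. -/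
def QZ.proj (p : ℕ) [Fact p.Prime] : QZ →+ QpZp p :=
  QuotientAddGroup.map _ _ (Rat.castHom ℚ_[p] : ℚ →+ ℚ_[p]) (by
    rw [AddSubgroup.zmultiples_le]
    simp)

/-- The absolute Galois group `Gal(κ^sep / κ)`, with the Krull topology. -/
abbrev Gsep (κ : Type*) [Field κ] : Type _ := SeparableClosure κ ≃ₐ[κ] SeparableClosure κ

instance (κ : Type*) [Field κ] (p : ℕ) [CharP κ p] : CharP (SeparableClosure κ) p :=
  charP_of_injective_algebraMap (algebraMap κ (SeparableClosure κ)).injective p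

/-! ### The Artin-Schreier-Witt morphism -/

section ASW

variable (p : ℕ) [hp : Fact p.Prime] (κ : Type*) [Field κ] [CharP κ p]

/-- `IsASW p κ m x χ`: the character `χ : G_κ → p^{-(m+1)}ℤ/ℤ ⊆ ℚ_p/ℤ_p` is
the Artin-Schreier-Witt character `δ(x)` of `x ∈ W p m κ`: there is a solution
`ν ∈ W p m κ^sep` of `F(ν) - ν = x` such that, for every `γ`, `γ(ν) - ν` is the element `a`
of `ℤ/p^{m+1}ℤ = W p m 𝔽_p` and `χ(γ) = a/p^{m+1}`. -/
def IsASW (m : ℕ) (x : W p m κ) (χ : H1 (Gsep κ) (QpZp p)) : Prop :=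
  ∃ ν : W p m (SeparableClosure κ),
    W.frob p _ m ν - ν = W.map p m (algebraMap κ (SeparableClosure κ)) x ∧
    ∀ γ : Gsep κ, ∃ a : ℤ,
      W.map p m (γ : SeparableClosure κ →+* SeparableClosure κ) ν - ν = (a : W p m _) ∧
      χ.1 (Additive.ofMul γ) = QuotientAddGroup.mk ((a : ℚ_[p]) / (p : ℚ_[p]) ^ (m + 1))

theorem W.shift_intCast (R : Type*) [CommRing R] [CharP R p] (i j : ℕ) (h : i ≤ j) (a : ℤ) :
    W.shift p R i j h (a : W p i R) = ((p ^ (j - i) * a : ℤ) : W p j R) := by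
  have h1 : W.shift p R i j h 1 = ((p ^ (j - i) : ℕ) : W p j R) := by
    have h2 : ((p ^ (j - i) : ℕ) : W p j R) =
        WittVector.truncate (j + 1) ((p : WittVector p R) ^ (j - i)) := by simp
    rw [h2]
    ext l
    rw [W.coeff_shift, WittVector.coeff_truncate (n := j + 1)]
    split_ifs with hl
    · rw [WittVector.coeff_p_pow_eq_zero (R := R) (p := p) (by omega)]
    · have h3 : (1 : W p i R) = WittVector.truncate (i + 1) (1 : WittVector p R) := by simp
      rw [h3, WittVector.coeff_truncate]
      by_cases h4 : (l : ℕ) = j - i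
      · have h6 : ((p : WittVector p R) ^ (j - i)).coeff l = 1 := by
          rw [h4, WittVector.coeff_p_pow]
        rw [h6]
        simp [h4]
      · rw [WittVector.coeff_p_pow_eq_zero (R := R) (p := p) (j := (l : ℕ)) h4,
          WittVector.one_coeff_eq_of_pos]
        simp only
        omega
  have h5 : (a : W p i R) = a • (1 : W p i R) := by simp
  rw [h5, map_zsmul, h1]
  push_cast
  rw [zsmul_eq_mul, mul_comm]

variable {κ} in
theorem IsASW.shift {i j : ℕ} (h : i ≤ j) {x : W p i κ} {χ : H1 (Gsep κ) (QpZp p)}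
    (hx : IsASW p κ i x χ) : IsASW p κ j (W.shift p κ i j h x) χ := by
  obtain ⟨ν, hν, hγ⟩ := hx
  refine ⟨W.shift p _ i j h ν, ?_, fun γ => ?_⟩
  · rw [W.map_shift, ← hν, map_sub, W.frob, W.frob, W.map_shift]
  · obtain ⟨a, ha, hχ⟩ := hγ γ
    refine ⟨p ^ (j - i) * a, ?_, ?_⟩
    · rw [W.map_shift, ← map_sub, ha, W.shift_intCast]
    · rw [hχ]
      congr 1
      have hp0 : (p : ℚ_[p]) ≠ 0 := by exact_mod_cast hp.out.ne_zero
      obtain ⟨c, rfl⟩ := Nat.exists_eq_add_of_le h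
      push_cast
      rw [Nat.add_sub_cancel_left]
      field_simp
      ring

variable {κ} in
theorem IsASW.add {m : ℕ} {x y : W p m κ} {χ ψ : H1 (Gsep κ) (QpZp p)}
    (hx : IsASW p κ m x χ) (hy : IsASW p κ m y ψ) : IsASW p κ m (x + y) (χ + ψ) := by
  obtain ⟨ν, hν, hγ⟩ := hx
  obtain ⟨μ, hμ, hγ'⟩ := hy
  refine ⟨ν + μ, ?_, fun γ => ?_⟩
  · rw [map_add, map_add, ← hν, ← hμ]
    ring
  · obtain ⟨a, ha, hχ⟩ := hγ γ
    obtain ⟨b, hb, hψ⟩ := hγ' γ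
    refine ⟨a + b, ?_, ?_⟩
    · push_cast
      rw [← ha, ← hb, map_add]
      ring
    · change χ.1 _ + ψ.1 _ = _
      rw [hχ, hψ, ← QuotientAddGroup.mk_add]
      push_cast
      rw [add_div]

variable {κ} in
theorem IsASW.neg {m : ℕ} {x : W p m κ} {χ : H1 (Gsep κ) (QpZp p)}
    (hx : IsASW p κ m x χ) : IsASW p κ m (-x) (-χ) := by
  obtain ⟨ν, hν, hγ⟩ := hx
  refine ⟨-ν, ?_, fun γ => ?_⟩
  · rw [map_neg, map_neg, ← hν]
    ring
  · obtain ⟨a, ha, hχ⟩ := hγ γ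
    refine ⟨-a, ?_, ?_⟩
    · push_cast
      rw [← ha, map_neg]
      ring
    · change -χ.1 _ = _
      rw [hχ, ← QuotientAddGroup.mk_neg]
      push_cast
      rw [neg_div]

/-- The graph of the Artin-Schreier-Witt morphism `δ : CW(κ) → H¹(G_κ, ℚ_p/ℤ_p)`. -/
def aswGraph : AddSubgroup (CW p κ × H1 (Gsep κ) (QpZp p)) where
  carrier := {q | ∃ (m : ℕ) (x : W p m κ), CW.of p κ m x = q.1 ∧ IsASW p κ m x q.2}
  zero_mem' := by
    refine ⟨0, 0, map_zero _, 0, by simp, fun γ => ⟨0, by simp, ?_⟩⟩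
    rw [Int.cast_zero, zero_div]
    rfl
  add_mem' := by
    rintro ⟨_, χ⟩ ⟨_, ψ⟩ ⟨m, x, rfl, hx⟩ ⟨n, y, rfl, hy⟩
    refine ⟨max m n, W.shift p κ m _ (le_max_left m n) x + W.shift p κ n _ (le_max_right m n) y,
      ?_, (hx.shift p _).add p (hy.shift p _)⟩
    rw [map_add, CW.of_shift, CW.of_shift]
    rfl
  neg_mem' := by
    rintro ⟨_, χ⟩ ⟨m, x, rfl, hx⟩
    exact ⟨m, -x, map_neg _ _, hx.neg p⟩

end ASW

/-! ### Kato's filtrations -/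

section Kato

variable (p : ℕ) [hp : Fact p.Prime] (k : Type*) [Field k] [CharP k p]

instance : CharP (LaurentSeries k) p :=
  charP_of_injective_algebraMap (algebraMap k (LaurentSeries k)).injective p

/-- The extension `v(λ₀, …, λₘ) = min (pᵐ v(λ₀), …, p v(λₘ₋₁), v(λₘ))` to Witt vectors of the
`t`-adic valuation `v` of `k((t))`. -/
def W.val (m : ℕ) (x : W p m (LaurentSeries k)) : WithTop ℤ :=
  Finset.univ.inf fun i : Fin (m + 1) => p ^ (m - (i : ℕ)) • HahnSeries.addVal ℤ k (x.coeff i)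

theorem W.neg_le_val_iff {k : Type*} [Field k] (m d : ℕ) (x : W p m (LaurentSeries k)) :
    ((-(d : ℤ) : ℤ) : WithTop ℤ) ≤ W.val p k m x ↔
      ∀ i : Fin (m + 1),
        x.coeff i = 0 ∨ -(d : ℤ) ≤ (p : ℤ) ^ (m - (i : ℕ)) * (x.coeff i).order := by
  simp only [W.val, Finset.le_inf_iff, Finset.mem_univ, true_imp_iff, HahnSeries.addVal_apply]
  refine forall_congr' fun i => ?_
  by_cases hx : x.coeff i = 0
  · have : p ^ (m - (i : ℕ)) ≠ 0 := pow_ne_zero _ hp.out.ne_zero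
    simp only [hx, HahnSeries.orderTop_zero, true_or, iff_true]
    obtain ⟨c, hc⟩ := Nat.exists_eq_succ_of_ne_zero this
    rw [hc, succ_nsmul, WithTop.add_top]
    exact le_top
  · rw [← HahnSeries.order_eq_orderTop_of_ne_zero hx, ← WithTop.coe_nsmul, WithTop.coe_le_coe]
    simp [hx]

/-- In characteristic `p`, multiplication by a Teichmüller representative `[u]` multiplies the
`n`-th coefficient by `u ^ p ^ n`. -/
theorem coeff_teichmuller_mul {B : Type*} [CommRing B] [CharP B p] (u : B) (x : WittVector p B)
    (n : ℕ) : (WittVector.teichmuller p u * x).coeff n = u ^ p ^ n * x.coeff n := by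
  induction n generalizing u x with
  | zero => simp [WittVector.mul_coeff_zero]
  | succ n ih =>
    have h1 : ∀ (b : B) (y : WittVector p B) (j : ℕ),
        (WittVector.teichmuller p b + WittVector.verschiebung y).coeff j =
          (WittVector.teichmuller p b).coeff j + (WittVector.verschiebung y).coeff j := by
      intro b y j
      refine WittVector.coeff_add_of_disjoint j _ _ fun i => ?_
      rcases i with _ | i
      · exact Or.inr (WittVector.verschiebung_coeff_zero _)
      · exact Or.inl (WittVector.teichmuller_coeff_pos _ _ _ i.succ_pos)
    have h2 : x = WittVector.teichmuller p (x.coeff 0) +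
        WittVector.verschiebung (WittVector.mk p fun i => x.coeff (i + 1)) := by
      ext j
      rw [h1]
      rcases j with _ | j
      · simp
      · rw [WittVector.teichmuller_coeff_pos _ _ _ j.succ_pos, zero_add,
          WittVector.verschiebung_coeff_succ, WittVector.coeff_mk]
    have h3 : WittVector.teichmuller p u * x = WittVector.teichmuller p (u * x.coeff 0) +
        WittVector.verschiebung (WittVector.teichmuller p (u ^ p) *
          WittVector.mk p fun i => x.coeff (i + 1)) := by
      conv_lhs => rw [h2]
      rw [mul_add, ← map_mul]
      congr 1
      rw [mul_comm, ← WittVector.verschiebung_mul_frobenius, mul_comm,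
        WittVector.frobenius_eq_map_frobenius, WittVector.map_teichmuller, frobenius_def]
    rw [h3, h1, WittVector.teichmuller_coeff_pos _ _ _ n.succ_pos, zero_add,
      WittVector.verschiebung_coeff_succ, ih, WittVector.coeff_mk, ← pow_mul, pow_succ']

theorem W.exists_addSubgroup (m d : ℕ) : ∃ S : AddSubgroup (W p m (LaurentSeries k)),
    ∀ x, x ∈ S ↔ ((-(d : ℤ) : ℤ) : WithTop ℤ) ≤ W.val p k m x := by
  -- The condition `v(λ) ≥ -d` means that `[t ^ (d / p ^ m)] * λ` is integral in `W_m(k((t^ℚ)))`.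
  let ι : ℤ →+ ℚ := Int.castAddHom ℚ
  let f : LaurentSeries k →+* HahnSeries ℚ k :=
    HahnSeries.embDomainRingHom ι Int.cast_injective fun _ _ => Int.cast_le
  have : CharP (HahnSeries ℚ k) p :=
    charP_of_injective_algebraMap (algebraMap k (HahnSeries ℚ k)).injective p
  let u : HahnSeries ℚ k := HahnSeries.single ((d : ℚ) / p ^ m) 1
  let O : Subring (HahnSeries ℚ k) :=
    { carrier := {x | 0 ≤ x.orderTop}
      mul_mem' := fun {a b} (ha : 0 ≤ a.orderTop) (hb : 0 ≤ b.orderTop) =>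
        show 0 ≤ (a * b).orderTop from (add_nonneg ha hb).trans HahnSeries.orderTop_add_le_mul
      one_mem' := by simp
      add_mem' := fun {a b} (ha : 0 ≤ a.orderTop) (hb : 0 ≤ b.orderTop) =>
        show 0 ≤ (a + b).orderTop from
          (le_min ha hb).trans HahnSeries.min_orderTop_le_orderTop_add
      zero_mem' := by simp
      neg_mem' := fun {a} ha => by simpa using ha }
  let P : W p m (LaurentSeries k) → Prop := fun x =>
    WittVector.teichmuller p u * WittVector.map f x.out ∈ (WittVector.map O.subtype).range
  have hO : ∀ y : WittVector p (HahnSeries ℚ k),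
      y ∈ (WittVector.map O.subtype).range ↔ ∀ i, y.coeff i ∈ O := by
    intro y
    constructor
    · rintro ⟨z, rfl⟩ i
      rw [WittVector.map_coeff]
      exact (z.coeff i).2
    · intro h
      refine ⟨WittVector.mk p fun i => ⟨y.coeff i, h i⟩, ?_⟩
      ext i : 1
      rw [WittVector.map_coeff]
      rfl
  have hu : ∀ i : ℕ, u ^ p ^ i = HahnSeries.single ((p : ℚ) ^ i * (d / p ^ m)) 1 := by
    intro i
    rw [HahnSeries.single_pow, one_pow, nsmul_eq_mul]
    push_cast
    rfl
  have hcoef : ∀ (i : ℕ) (hi : i ≤ m) (a : LaurentSeries k), u ^ p ^ i * f a ∈ O ↔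
      a = 0 ∨ -(d : ℤ) ≤ (p : ℤ) ^ (m - i) * a.order := by
    intro i hi a
    by_cases ha : a = 0
    · simp [ha]
    · have h1 : (f a).orderTop = ((a.order : ℚ) : WithTop ℚ) := by
        change (HahnSeries.embDomain _ a).orderTop = _
        rw [HahnSeries.orderTop_embDomain, ← HahnSeries.order_eq_orderTop_of_ne_zero ha]
        rfl
      have h2 : (u ^ p ^ i * f a).orderTop =
          (((p : ℚ) ^ i * (d / p ^ m) + a.order : ℚ) : WithTop ℚ) := by
        rw [HahnSeries.orderTop_mul, h1, hu, HahnSeries.orderTop_single one_ne_zero]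
        rfl
      change 0 ≤ (u ^ p ^ i * f a).orderTop ↔ _
      rw [h2, ← WithTop.coe_zero, WithTop.coe_le_coe]
      have hp0 : (0 : ℚ) < p := by exact_mod_cast hp.out.pos
      obtain ⟨c, rfl⟩ := Nat.exists_eq_add_of_le hi
      rw [Nat.add_sub_cancel_left]
      have h3 : (p : ℚ) ^ i * (d / p ^ (i + c)) + a.order = (d + p ^ c * a.order) / p ^ c := by
        field_simp
        ring
      rw [h3, le_div_iff₀ (by positivity), zero_mul]
      simp only [ha, false_or]
      constructor
      · intro h
        have : (0 : ℤ) ≤ d + p ^ c * a.order := by exact_mod_cast h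
        linarith
      · intro h
        have : (0 : ℤ) ≤ d + p ^ c * a.order := by linarith
        exact_mod_cast this
  have key : ∀ x : W p m (LaurentSeries k), ∀ y : WittVector p (LaurentSeries k),
      WittVector.truncate (m + 1) y = x →
      WittVector.teichmuller p u * WittVector.map f y ∈ (WittVector.map O.subtype).range →
      ((-(d : ℤ) : ℤ) : WithTop ℤ) ≤ W.val p k m x := by
    rintro _ y rfl h
    rw [W.neg_le_val_iff]
    intro i
    have h1 := (hO _).1 h i
    rw [coeff_teichmuller_mul, WittVector.map_coeff] at h1
    rw [WittVector.coeff_truncate]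
    exact (hcoef i (Nat.lt_succ_iff.1 i.2) _).1 h1
  have key' : ∀ x : W p m (LaurentSeries k), ((-(d : ℤ) : ℤ) : WithTop ℤ) ≤ W.val p k m x →
      WittVector.teichmuller p u * WittVector.map f x.out ∈
        (WittVector.map O.subtype).range := by
    intro x h
    rw [W.neg_le_val_iff] at h
    rw [hO]
    intro i
    rw [coeff_teichmuller_mul, WittVector.map_coeff]
    by_cases hi : i < m + 1
    · have h1 := (hcoef i (Nat.lt_succ_iff.1 hi) _).2 (h ⟨i, hi⟩)
      have h2 : x.out.coeff i = x.coeff ⟨i, hi⟩ := TruncatedWittVector.coeff_out x ⟨i, hi⟩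
      rwa [h2]
    · have h2 : x.out.coeff i = 0 := by
        rw [TruncatedWittVector.out]
        simp [hi]
      rw [h2, map_zero, mul_zero]
      exact O.zero_mem
  have hout : ∀ x : W p m (LaurentSeries k), WittVector.truncate (m + 1) x.out = x :=
    fun x => TruncatedWittVector.truncateFun_out x
  refine ⟨{ carrier := {x | ((-(d : ℤ) : ℤ) : WithTop ℤ) ≤ W.val p k m x}
            zero_mem' := ?_, add_mem' := fun {x y} hx hy => ?_, neg_mem' := fun {x} hx => ?_ },
    fun x => Iff.rfl⟩
  · refine key _ (x.out + y.out) (by rw [map_add, hout, hout]) ?_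
    rw [map_add, mul_add]
    exact add_mem (key' x hx) (key' y hy)
  · refine key 0 0 (map_zero _) ?_
    rw [map_zero, mul_zero]
    exact zero_mem _
  · refine key _ (-x.out) (by rw [map_neg, hout]) ?_
    rw [map_neg, mul_neg]
    exact neg_mem (key' x hx)

/-- Kato's filtration `Fil_d(W_m(E)) = {λ | v(λ) ≥ -d}`, where `E = k((t))`. -/
def W.fil (m d : ℕ) : AddSubgroup (W p m (LaurentSeries k)) where
  carrier := {x | ((-(d : ℤ) : ℤ) : WithTop ℤ) ≤ W.val p k m x}
  zero_mem' := by
    obtain ⟨S, hS⟩ := W.exists_addSubgroup p k m d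
    exact (hS 0).1 S.zero_mem
  add_mem' := fun {x y} hx hy => by
    obtain ⟨S, hS⟩ := W.exists_addSubgroup p k m d
    exact (hS _).1 (S.add_mem ((hS x).2 hx) ((hS y).2 hy))
  neg_mem' := fun {x} hx => by
    obtain ⟨S, hS⟩ := W.exists_addSubgroup p k m d
    exact (hS _).1 (S.neg_mem ((hS x).2 hx))

theorem W.shift_mem_fil {i j d : ℕ} (h : i ≤ j) {x : W p i (LaurentSeries k)}
    (hx : x ∈ W.fil p k i d) : W.shift p _ i j h x ∈ W.fil p k j d := by
  refine (W.neg_le_val_iff p j d _).2 fun l => ?_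
  have hx := (W.neg_le_val_iff p i d x).1 hx
  rw [W.coeff_shift]
  split_ifs with hl
  · exact Or.inl rfl
  · have h1 := hx ⟨l - (j - i), by omega⟩
    have h2 : i - (l - (j - i)) = j - l := by omega
    simpa only [h2] using h1

/-- Kato's filtration `Fil_d(CW(E)) = ⋃ₘ Fil_d(W_m(E))`, where `E = k((t))`. -/
def CW.fil (d : ℕ) : AddSubgroup (CW p (LaurentSeries k)) where
  carrier := {f | ∃ (m : ℕ) (x : W p m (LaurentSeries k)), x ∈ W.fil p k m d ∧ CW.of p _ m x = f}
  zero_mem' := ⟨0, 0, zero_mem _, map_zero _⟩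
  add_mem' := by
    rintro _ _ ⟨m, x, hx, rfl⟩ ⟨n, y, hy, rfl⟩
    refine ⟨max m n, W.shift p _ m _ (le_max_left m n) x + W.shift p _ n _ (le_max_right m n) y,
      add_mem (W.shift_mem_fil p k _ hx) (W.shift_mem_fil p k _ hy), ?_⟩
    rw [map_add, CW.of_shift, CW.of_shift]
  neg_mem' := by
    rintro _ ⟨m, x, hx, rfl⟩
    exact ⟨m, -x, neg_mem hx, map_neg _ _⟩

/-- Kato's filtration on `H¹(G_E, ℚ_p/ℤ_p)`, where `E = k((t))`: the image of `Fil_d(CW(E))` under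
the Artin-Schreier-Witt morphism. -/
def H1.fil (d : ℕ) : AddSubgroup (H1 (Gsep (LaurentSeries k)) (QpZp p)) :=
  (aswGraph p (LaurentSeries k) ⊓ (CW.fil p k d).prod ⊤).map (AddMonoidHom.snd _ _)

/-- Kato's filtration on `H¹(G_E, ℚ/ℤ)`, where `E = k((t))`: the inverse image of
`Fil_d(H¹(G_E, ℚ_p/ℤ_p))` under the projection on the `p`-component. -/
def H1.filQZ (d : ℕ) : AddSubgroup (H1 (Gsep (LaurentSeries k)) QZ) :=
  (H1.fil p k d).comap (H1.map _ (QZ.proj p))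

/-- The co-monomial
`λ t^{-d} = (…, 0, 0, λ₀ t^{-n}, λ₁ t^{-np}, …, λₘ t^{-d})`, `d = n pᵐ`, in `CW(k((t)))`. -/
def comonomial (n m : ℕ) (x : W p m k) : CW p (LaurentSeries k) :=
  CW.of p _ m (TruncatedWittVector.mk p fun i =>
    HahnSeries.single (-((n * p ^ (i : ℕ) : ℕ) : ℤ)) (x.coeff i))

end Kato

/-- The step before the `d`-th one of an increasing filtration indexed by `ℕ`, with the convention
that `Fil_{-1} = 0`. -/
def prevFil {M : Type*} [AddCommGroup M] (F : ℕ → AddSubgroup M) : ℕ → AddSubgroup M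
  | 0 => ⊥
  | d + 1 => F d

/-- The graded piece `Gr_d = Fil_d / Fil_{d-1}` of an increasing filtration indexed by `ℕ`. -/
abbrev Gr {M : Type*} [AddCommGroup M] (F : ℕ → AddSubgroup M) (d : ℕ) : Type _ :=
  F d ⧸ (prevFil F d).addSubgroupOf (F d)

/-- The class in `Gr_d` of an element of `Fil_d`. -/
def Gr.mk {M : Type*} [AddCommGroup M] (F : ℕ → AddSubgroup M) (d : ℕ) : F d →+ Gr F d :=
  QuotientAddGroup.mk' _

/-- `J_p`: the set of the integers `n ≥ 1` prime to `p`. -/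
abbrev Jp (p : ℕ) : Type := {n : ℕ // 1 ≤ n ∧ n.Coprime p}

/-- The set of the prime numbers `ℓ ≠ p`. -/
abbrev PrimesNe (p : ℕ) : Type := {l : ℕ // l.Prime ∧ l ≠ p}

instance (p : ℕ) (l : PrimesNe p) : Fact (l : ℕ).Prime := ⟨l.2.1⟩

end KatoSwan

end

open scoped DirectSum

noncomputable section

namespace KatoSwan

/-! ### Truncated Witt vectors -/

section Witt

variable (p : ℕ) [hp : Fact p.Prime]

/-! Three ingredients combine: Artin–Schreier–Witt theory, a normal form for covectors over `E =
k((t))`, and the primary decomposition of characters.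

Over any field `κ` of characteristic `p`, the equation `F(ν) - ν = x` is solvable over `κ^sep`,
because `b ^ p - b = a` is separable. Then `γ(ν) - ν` is fixed by `F`, and the `F`-fixed truncated
Witt vectors of a field are the integers modulo `p^{m+1}`; this defines `δ`. The character vanishes
exactly when `ν` is Galois invariant, so the kernel is `(F - 1) CW(κ)`. A character has finite
image, and an additive Hilbert 90 for Witt vectors (`W.exists_map_sub_eq`) makes it a coboundary
`γ(ν) - ν`; since `F(ν) - ν` is invariant, it descends to `κ`. This gives `aswEquiv`.

For the normal form, the difficulty is that Witt addition mixes coefficients, so that taking leading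
coefficients is not visibly additive. After `t ↦ t ^ p ^ m`, multiplication by the Teichmüller
representative of `t ^ d` makes `Fil_d` integral, and reduction modulo `t` is then an additive
leading-vector map (`W.exists_leading`). For `d = n pᵐ` with `n` prime to `p`, divisibility confines
the leading vector to its last `m + 1` places, so exactly one co-monomial `λ t^{-d}` cancels it.
Induction on the pole order gives `CW(E) = (⨁ W_m(k)) ⊕ CW(k[[t]])`, the sum being over the pairs
`(n, m)` (`coeffsEquiv`).

Now divide by `F - 1`. As `F` sends `λ t^{-npᵐ}` to the co-monomial of `VF λ` in degree `n p^{m+1}`,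
the summands with the same `n` are glued along `VF` into `CW~(k)`. On `CW(k[[t]])` only the constant
term survives, since `-∑ a ^ p ^ j` converges and solves `b ^ p - b = a` when `a(0) = 0`. This gives
`residueEquiv`, compatible with the filtrations because its inverse lifts each component to a
co-monomial of controlled degree. Since `VF = p`, the class of `λ t^{-d}` drops a step of the
filtration exactly when `λ` is divisible by `p`.

With values in `ℚ/ℤ`, compactness of the Galois group bounds the order of a character, which is then
the sum of its finitely many primary components; the filtration constrains only the one at `p`. -/

theorem W.map_map {R S T : Type*} [CommRing R] [CommRing S] [CommRing T] (m : ℕ) (g : S →+* T)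
    (f : R →+* S) (x : W p m R) : W.map p m g (W.map p m f x) = W.map p m (g.comp f) x := rfl

theorem W.map_injective {R S : Type*} [CommRing R] [CommRing S] (m : ℕ) {f : R →+* S}
    (hf : Function.Injective f) : Function.Injective (W.map p m f) := by
  intro x y h
  ext i
  apply hf
  rw [← W.coeff_map, ← W.coeff_map, h]

theorem W.map_eq_zero_iff {R S : Type*} [CommRing R] [CommRing S] (m : ℕ) (f : R →+* S)
    (x : W p m R) : W.map p m f x = 0 ↔ ∀ i, f (x.coeff i) = 0 := by
  constructor
  · intro h i
    rw [← W.coeff_map, h, TruncatedWittVector.coeff_zero]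
  · intro h
    ext i
    rw [W.coeff_map, h, TruncatedWittVector.coeff_zero]

theorem W.map_truncate {R S : Type*} [CommRing R] [CommRing S] (m : ℕ) (f : R →+* S)
    (x : WittVector p R) : W.map p m f (WittVector.truncate (m + 1) x) =
      WittVector.truncate (m + 1) (WittVector.map f x) := by
  ext i
  rw [W.coeff_map, WittVector.coeff_truncate, WittVector.coeff_truncate, WittVector.map_coeff]

theorem W.map_frob {R S : Type*} [CommRing R] [CharP R p] [CommRing S] [CharP S p] (m : ℕ)
    (f : R →+* S) (x : W p m R) : W.map p m f (W.frob p R m x) = W.frob p S m (W.map p m f x) := by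
  rw [W.frob, W.frob, W.map_map, W.map_map, RingHom.frobenius_comm]

theorem W.shift_injective (R : Type*) [CommRing R] (i j : ℕ) (h : i ≤ j) :
    Function.Injective (W.shift p R i j h) := by
  intro x y hxy
  ext l
  have h1 := congrArg (fun z => TruncatedWittVector.coeff ⟨l + (j - i), by omega⟩ z) hxy
  simpa [W.coeff_shift] using h1

theorem W.shift_self (R : Type*) [CommRing R] (i : ℕ) (x : W p i R) :
    W.shift p R i i le_rfl x = x := by
  ext l
  rw [W.coeff_shift]
  simp

theorem W.shift_shift (R : Type*) [CommRing R] {i j l : ℕ} (hij : i ≤ j) (hjl : j ≤ l)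
    (x : W p i R) : W.shift p R j l hjl (W.shift p R i j hij x) =
      W.shift p R i l (hij.trans hjl) x := by
  ext a
  simp only [W.coeff_shift]
  split_ifs with h1 h2 h3 h4
  · rfl
  · omega
  · rfl
  · omega
  · omega
  · congr 1
    ext
    simp only
    omega

instance (R : Type*) [CommRing R] :
    DirectedSystem (fun m : ℕ => W p m R) fun i j h => W.shift p R i j h where
  map_self i x := W.shift_self p R i x
  map_map _ _ _ hij hjk x := W.shift_shift p R hij hjk x

theorem CW.of_injective (R : Type*) [CommRing R] (m : ℕ) : Function.Injective (CW.of p R m) := by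
  rw [injective_iff_map_eq_zero]
  intro x hx
  obtain ⟨j, hj, h⟩ := AddCommGroup.DirectLimit.of.zero_exact (G := fun m : ℕ => W p m R) m x hx
  exact W.shift_injective p R m j hj (h.trans (map_zero _).symm)

theorem CW.exists_of {R : Type*} [CommRing R] (f : CW p R) : ∃ m x, CW.of p R m x = f :=
  AddCommGroup.DirectLimit.induction_on f fun m x => ⟨m, x, rfl⟩

theorem CW.map_of {R S : Type*} [CommRing R] [CommRing S] (f : R →+* S) (m : ℕ) (x : W p m R) :
    CW.map p f (CW.of p R m x) = CW.of p S m (W.map p m f x) :=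
  AddCommGroup.DirectLimit.lift_of (G := fun m : ℕ => W p m R) _ _ _ m x

theorem CW.map_map {R S T : Type*} [CommRing R] [CommRing S] [CommRing T] (g : S →+* T)
    (f : R →+* S) (x : CW p R) : CW.map p g (CW.map p f x) = CW.map p (g.comp f) x := by
  obtain ⟨m, x, rfl⟩ := CW.exists_of p x
  simp only [CW.map_of, W.map_map]

theorem CW.map_injective {R S : Type*} [CommRing R] [CommRing S] {f : R →+* S}
    (hf : Function.Injective f) : Function.Injective (CW.map p f) := by
  rw [injective_iff_map_eq_zero]
  intro x hx
  obtain ⟨m, x, rfl⟩ := CW.exists_of p x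
  rw [CW.map_of, ← map_zero (CW.of p S m)] at hx
  have h := CW.of_injective p S m hx
  rw [← map_zero (W.map p m f)] at h
  rw [W.map_injective p m hf h, map_zero]

theorem CW.frob_of (R : Type*) [CommRing R] [CharP R p] (m : ℕ) (x : W p m R) :
    CW.frob p R (CW.of p R m x) = CW.of p R m (W.frob p R m x) := CW.map_of p _ m x

theorem CW.map_frob {R S : Type*} [CommRing R] [CharP R p] [CommRing S] [CharP S p] (f : R →+* S)
    (x : CW p R) : CW.map p f (CW.frob p R x) = CW.frob p S (CW.map p f x) := by
  rw [CW.frob, CW.frob, CW.map_map, CW.map_map, RingHom.frobenius_comm]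

theorem CW.mem_asw {R : Type*} [CommRing R] [CharP R p] (x : CW p R) :
    x ∈ CW.asw p R ↔ ∃ y, CW.frob p R y - y = x := Iff.rfl

theorem CW.map_mem_asw {R S : Type*} [CommRing R] [CharP R p] [CommRing S] [CharP S p]
    (f : R →+* S) {x : CW p R} (hx : x ∈ CW.asw p R) : CW.map p f x ∈ CW.asw p S := by
  obtain ⟨y, rfl⟩ := (CW.mem_asw p x).1 hx
  exact (CW.mem_asw p _).2 ⟨CW.map p f y, by rw [map_sub, CW.map_frob]⟩

theorem W.coeff_shiftFrob (R : Type*) [CommRing R] [CharP R p] (i j : ℕ) (h : i ≤ j) (x : W p i R)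
    (l : Fin (j + 1)) : (W.shiftFrob p R i j h x).coeff l =
      if (l : ℕ) < j - i then 0 else x.coeff ⟨l - (j - i), by omega⟩ ^ p ^ (j - i) := rfl

theorem W.shiftFrob_injective (R : Type*) [CommRing R] [CharP R p] [IsReduced R] (i j : ℕ)
    (h : i ≤ j) : Function.Injective (W.shiftFrob p R i j h) :=
  (W.shift_injective p R i j h).comp (W.map_injective p i (iterateFrobenius_inj R p _))

instance (R : Type*) [CommRing R] [CharP R p] :
    DirectedSystem (fun m : ℕ => W p m R) fun i j h => W.shiftFrob p R i j h where
  map_self i x := by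
    ext l
    rw [W.coeff_shiftFrob]
    simp
  map_map i j l hij hjl x := by
    ext a
    simp only [W.coeff_shiftFrob]
    have hp0 : p ≠ 0 := hp.out.ne_zero
    split_ifs with h1 h2 h3 h4
    · rfl
    · omega
    · exact zero_pow (pow_ne_zero _ hp0)
    · omega
    · omega
    · rw [← pow_mul, ← pow_add]
      congr 2
      · ext
        simp only
        omega
      · omega

theorem CWt.of_shiftFrob (R : Type*) [CommRing R] [CharP R p] (i j : ℕ) (h : i ≤ j) (x : W p i R) :
    CWt.of p R j (W.shiftFrob p R i j h x) = CWt.of p R i x :=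
  AddCommGroup.DirectLimit.of_f (G := fun m : ℕ => W p m R) (f := W.shiftFrob p R) h x

/-- Over a reduced ring Frobenius is injective, so all transition maps `VF` are injective and
nothing dies in the limit. This is what makes `Fil_m(CW~(k))` a copy of `W_m(k)`. -/
theorem CWt.of_injective (R : Type*) [CommRing R] [CharP R p] [IsReduced R] (m : ℕ) :
    Function.Injective (CWt.of p R m) := by
  rw [injective_iff_map_eq_zero]
  intro x hx
  obtain ⟨j, hj, h⟩ := AddCommGroup.DirectLimit.of.zero_exact (G := fun m : ℕ => W p m R) m x hx
  exact W.shiftFrob_injective p R m j hj (h.trans (map_zero _).symm)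

theorem CWt.exists_of {R : Type*} [CommRing R] [CharP R p] (f : CWt p R) :
    ∃ m x, CWt.of p R m x = f :=
  AddCommGroup.DirectLimit.induction_on f fun m x => ⟨m, x, rfl⟩

theorem CWt.fil_mono (R : Type*) [CommRing R] [CharP R p] {i j : ℕ} (h : i ≤ j) :
    CWt.fil p R i ≤ CWt.fil p R j := by
  rintro _ ⟨x, rfl⟩
  exact ⟨W.shiftFrob p R i j h x, CWt.of_shiftFrob p R i j h x⟩

theorem W.exists_shift_of_coeff_zero (R : Type*) [CommRing R] {i j : ℕ} (h : i ≤ j) (x : W p j R)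
    (hx : ∀ l : Fin (j + 1), (l : ℕ) < j - i → x.coeff l = 0) : ∃ y, W.shift p R i j h y = x := by
  refine ⟨TruncatedWittVector.mk p fun l => x.coeff ⟨l + (j - i), by omega⟩, ?_⟩
  ext l
  rw [W.coeff_shift]
  split_ifs with hl
  · rw [hx l hl]
  · rw [TruncatedWittVector.coeff_mk]
    congr 1
    ext
    simp only
    omega

/-- The zeroth ghost component, as a ring homomorphism. -/
def W.coeffZero (R : Type*) [CommRing R] (m : ℕ) : W p m R →+* R where
  toFun x := x.coeff 0
  map_zero' := TruncatedWittVector.coeff_zero p (m + 1) R 0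
  map_one' := by
    have h : (1 : W p m R) = WittVector.truncate (m + 1) 1 := (map_one _).symm
    rw [h, WittVector.coeff_truncate]
    exact WittVector.one_coeff_zero p R
  map_add' x y := by
    obtain ⟨x, rfl⟩ := WittVector.truncate_surjective p (m + 1) R x
    obtain ⟨y, rfl⟩ := WittVector.truncate_surjective p (m + 1) R y
    simp only [← map_add, WittVector.coeff_truncate]
    exact WittVector.add_coeff_zero x y
  map_mul' x y := by
    obtain ⟨x, rfl⟩ := WittVector.truncate_surjective p (m + 1) R x
    obtain ⟨y, rfl⟩ := WittVector.truncate_surjective p (m + 1) R y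
    simp only [← map_mul, WittVector.coeff_truncate]
    exact WittVector.mul_coeff_zero x y

theorem W.coeffZero_apply (R : Type*) [CommRing R] (m : ℕ) (x : W p m R) :
    W.coeffZero p R m x = x.coeff 0 := rfl

theorem W.exists_shift_of_coeffZero (R : Type*) [CommRing R] (m : ℕ) (x : W p (m + 1) R)
    (hx : W.coeffZero p R (m + 1) x = 0) : ∃ y, W.shift p R m (m + 1) m.le_succ y = x := by
  refine W.exists_shift_of_coeff_zero p R _ x fun l hl => ?_
  have : l = 0 := by
    ext
    simp at hl
    simpa using hl
  rw [this]
  exact hx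

theorem W.ext_coeffZero {R : Type*} [CommRing R] {x y : W p 0 R}
    (h : W.coeffZero p R 0 x = W.coeffZero p R 0 y) : x = y := by
  ext l
  rw [Subsingleton.elim (α := Fin 1) l 0]
  exact h

theorem W.frob_shift (R : Type*) [CommRing R] [CharP R p] (i j : ℕ) (h : i ≤ j) (x : W p i R) :
    W.frob p R j (W.shift p R i j h x) = W.shift p R i j h (W.frob p R i x) :=
  W.map_shift p i j h _ x

theorem W.coeffZero_frob (R : Type*) [CommRing R] [CharP R p] (m : ℕ) (x : W p m R) :
    W.coeffZero p R m (W.frob p R m x) = W.coeffZero p R m x ^ p := rfl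

/-- If `F - 1` is surjective on the kernel of `R → S`, it is so on that of `W R → W S`. -/
theorem W.exists_frob_sub {R S : Type*} [CommRing R] [CharP R p] [CommRing S] (φ : R →+* S)
    (hφ : ∀ a, φ a = 0 → ∃ b, φ b = 0 ∧ b ^ p - b = a) (m : ℕ) (x : W p m R)
    (hx : W.map p m φ x = 0) : ∃ y, W.frob p R m y - y = x := by
  induction m with
  | zero =>
    obtain ⟨b, -, hb⟩ := hφ (x.coeff 0) ((W.map_eq_zero_iff p 0 φ x).1 hx 0)
    refine ⟨TruncatedWittVector.mk p fun _ => b, W.ext_coeffZero p ?_⟩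
    rw [map_sub, W.coeffZero_frob, W.coeffZero_apply, W.coeffZero_apply,
      TruncatedWittVector.coeff_mk, hb]
  | succ m ih =>
    obtain ⟨b, hb0, hb⟩ := hφ (x.coeff 0) ((W.map_eq_zero_iff p (m + 1) φ x).1 hx 0)
    -- Solve for the zeroth coefficient and lift the solution by Teichmüller. What remains of `x`
    -- has zeroth coefficient zero, hence is the Verschiebung of a shorter vector `y`, still killed
    -- by `φ`.
    let b' : W p (m + 1) R := WittVector.truncate (m + 1 + 1) (WittVector.teichmuller p b)
    have hb' : W.map p (m + 1) φ b' = 0 := by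
      rw [W.map_truncate, WittVector.map_teichmuller, hb0, WittVector.teichmuller_zero, map_zero]
    have hb'' : W.coeffZero p R (m + 1) b' = b := by
      rw [W.coeffZero_apply, WittVector.coeff_truncate]
      exact WittVector.teichmuller_coeff_zero p b
    obtain ⟨y, hy⟩ := W.exists_shift_of_coeffZero p R m (x - (W.frob p R _ b' - b')) (by
      rw [map_sub, map_sub, W.coeffZero_frob, hb'', hb]
      exact sub_self _)
    have hy0 : W.map p m φ y = 0 := by
      apply W.shift_injective p S m (m + 1) m.le_succ
      rw [← W.map_shift, hy, map_sub, map_sub, hx, hb', map_zero, sub_zero, zero_sub, neg_eq_zero]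
      rw [W.map_eq_zero_iff] at hb' ⊢
      intro i
      change φ (b'.coeff i ^ p) = 0
      rw [map_pow, hb', zero_pow hp.out.ne_zero]
    obtain ⟨z, hz⟩ := ih y hy0
    refine ⟨b' + W.shift p R m (m + 1) m.le_succ z, ?_⟩
    rw [map_add, W.frob_shift, add_sub_add_comm, ← map_sub, hz, hy]
    ring

/-- The elements fixed by Frobenius are the integers, over a field. -/
theorem W.exists_intCast_of_frob_eq {R : Type*} [Field R] [CharP R p] (m : ℕ)
    (x : W p m R) (hx : W.frob p R m x = x) : ∃ a : ℤ, x = a := by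
  have h0 : ∀ b : R, b ^ p = b → ∃ a : ℤ, b = a := by
    intro b hb
    obtain ⟨a, rfl⟩ := (_root_.mem_bot_iff_intCast p R).1
      ((Subfield.mem_bot_iff_pow_eq_self R p).2 hb)
    exact ⟨a, rfl⟩
  induction m with
  | zero =>
    obtain ⟨a, ha⟩ := h0 (W.coeffZero p R 0 x) (by rw [← W.coeffZero_frob, hx])
    exact ⟨a, W.ext_coeffZero p (by rw [ha, map_intCast])⟩
  | succ m ih =>
    obtain ⟨a, ha⟩ := h0 (W.coeffZero p R (m + 1) x) (by rw [← W.coeffZero_frob, hx])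
    obtain ⟨y, hy⟩ := W.exists_shift_of_coeffZero p R m (x - a) (by
      rw [map_sub, ha, map_intCast, sub_self])
    obtain ⟨b, rfl⟩ := ih y (W.shift_injective p R m (m + 1) m.le_succ (by
      rw [← W.frob_shift, hy, map_sub, hx, map_intCast]))
    rw [W.shift_intCast] at hy
    exact ⟨p ^ (m + 1 - m) * b + a, by rw [Int.cast_add, hy, sub_add_cancel]⟩

/-- The integers in `W p m R` form a copy of `ℤ/p^{m+1}ℤ` whatever `R` is. Induction works because
`V` sends the integer `b` to `p b` and is injective. -/
theorem W.intCast_eq_zero_iff {R : Type*} [CommRing R] [CharP R p] (m : ℕ) (a : ℤ) :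
    (a : W p m R) = 0 ↔ (p : ℤ) ^ (m + 1) ∣ a := by
  induction m generalizing a with
  | zero =>
    have h1 : (p : ℤ) ^ (0 + 1) = p := by ring
    rw [h1, ← CharP.intCast_eq_zero_iff R p a]
    constructor
    · intro h
      rw [← map_intCast (W.coeffZero p R 0), h, map_zero]
    · intro h
      refine W.ext_coeffZero p ?_
      rw [map_intCast, h, map_zero]
  | succ m ih =>
    have key : ∀ b : ℤ, ((p * b : ℤ) : W p (m + 1) R) = 0 ↔ (p : ℤ) ^ (m + 1 + 1) ∣ p * b := by
      intro b
      have h1 := W.shift_intCast p R m (m + 1) m.le_succ b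
      rw [Nat.add_sub_cancel_left, pow_one] at h1
      rw [← h1, _root_.map_eq_zero_iff _ (W.shift_injective p R m (m + 1) m.le_succ), ih,
        pow_succ' _ (m + 1)]
      exact (mul_dvd_mul_iff_left (by exact_mod_cast hp.out.ne_zero)).symm
    constructor
    · intro h
      have h1 : (p : ℤ) ∣ a := by
        rw [← CharP.intCast_eq_zero_iff R p a, ← map_intCast (W.coeffZero p R (m + 1)), h, map_zero]
      obtain ⟨b, rfl⟩ := h1
      exact (key b).1 h
    · intro h
      obtain ⟨b, rfl⟩ := (dvd_pow_self (p : ℤ) (m + 1).succ_ne_zero).trans h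
      exact (key b).2 h

/-- Multiplication by `p` is the composition of Verschiebung and Frobenius. -/
theorem W.nsmul_truncate (R : Type*) [CommRing R] [CharP R p] (m : ℕ) (x : WittVector p R) :
    p • (WittVector.truncate (m + 1 + 1) x : W p (m + 1) R) =
      W.shiftFrob p R m (m + 1) m.le_succ (WittVector.truncate (m + 1) x) := by
  rw [← map_nsmul, nsmul_eq_mul, mul_comm, ← WittVector.verschiebung_frobenius]
  ext l
  rw [W.coeff_shiftFrob, WittVector.coeff_truncate, WittVector.coeff_truncate]
  obtain ⟨l, hl⟩ := l
  rcases l with _ | l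
  · simp
  · simp [WittVector.coeff_frobenius_charP]

theorem W.nsmul_zero (R : Type*) [CommRing R] [CharP R p] (x : W p 0 R) : p • x = 0 := by
  refine W.ext_coeffZero p ?_
  rw [map_nsmul, map_zero, nsmul_eq_mul, CharP.cast_eq_zero, zero_mul]

end Witt

/-! ### Torsion in `ℚ_p / ℤ_p` and continuous characters -/

section QpZp

variable (p : ℕ) [hp : Fact p.Prime]

theorem QpZp.mk_eq_zero_iff (x : ℚ_[p]) : (QuotientAddGroup.mk x : QpZp p) = 0 ↔ ‖x‖ ≤ 1 :=
  QuotientAddGroup.eq_zero_iff x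

theorem QpZp.mk_div_eq_zero_iff (n : ℕ) (a : ℤ) :
    (QuotientAddGroup.mk ((a : ℚ_[p]) / (p : ℚ_[p]) ^ n) : QpZp p) = 0 ↔ (p : ℤ) ^ n ∣ a := by
  rw [QpZp.mk_eq_zero_iff, norm_div, norm_pow, Padic.norm_p, inv_pow, div_inv_eq_mul,
    ← Padic.norm_int_le_pow_iff_dvd, zpow_neg, zpow_natCast,
    ← le_div_iff₀ (by have := hp.out.pos; positivity), one_div]

/-- This is the same congruence as in `W.intCast_eq_zero_iff` for `n = m + 1`. It allows values of
characters and integral Witt vectors to be exchanged. -/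
theorem QpZp.mk_div_eq_iff (n : ℕ) (a b : ℤ) :
    (QuotientAddGroup.mk ((a : ℚ_[p]) / (p : ℚ_[p]) ^ n) : QpZp p) =
      QuotientAddGroup.mk ((b : ℚ_[p]) / (p : ℚ_[p]) ^ n) ↔ (p : ℤ) ^ n ∣ a - b := by
  rw [← QpZp.mk_div_eq_zero_iff, Int.cast_sub, sub_div, QuotientAddGroup.mk_sub, sub_eq_zero]

theorem QpZp.exists_pow_nsmul_eq_zero (x : QpZp p) : ∃ n : ℕ, p ^ n • x = 0 := by
  obtain ⟨x, rfl⟩ := QuotientAddGroup.mk_surjective x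
  obtain ⟨n, hn⟩ := pow_unbounded_of_one_lt ‖x‖ (by exact_mod_cast hp.out.one_lt : (1 : ℝ) < p)
  refine ⟨n, ?_⟩
  rw [← QuotientAddGroup.mk_nsmul, QpZp.mk_eq_zero_iff, nsmul_eq_mul, Nat.cast_pow, norm_mul,
    norm_pow, Padic.norm_p, inv_pow, inv_mul_le_one₀ (by have := hp.out.pos; positivity)]
  exact hn.le

theorem QpZp.exists_int_of_pow_nsmul_eq_zero (n : ℕ) (x : QpZp p) (hx : p ^ n • x = 0) :
    ∃ a : ℤ, x = QuotientAddGroup.mk ((a : ℚ_[p]) / (p : ℚ_[p]) ^ n) := by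
  obtain ⟨x, rfl⟩ := QuotientAddGroup.mk_surjective x
  rw [← QuotientAddGroup.mk_nsmul, QpZp.mk_eq_zero_iff, nsmul_eq_mul, Nat.cast_pow] at hx
  -- `p ^ n * x` is a `p`-adic integer. An integer congruent to it modulo `p ^ n` is the required
  -- numerator.
  let y : ℤ_[p] := ⟨_, hx⟩
  refine ⟨y.appr n, ?_⟩
  have h1 := (PadicInt.norm_le_pow_iff_mem_span_pow _ _).2 (PadicInt.appr_spec n y)
  have hp0 : (p : ℚ_[p]) ≠ 0 := by exact_mod_cast hp.out.ne_zero
  rw [← sub_eq_zero, ← QuotientAddGroup.mk_sub, QpZp.mk_eq_zero_iff]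
  have h2 : x - ((y.appr n : ℤ) : ℚ_[p]) / (p : ℚ_[p]) ^ n =
      ((y - y.appr n : ℤ_[p]) : ℚ_[p]) / (p : ℚ_[p]) ^ n := by
    have h3 : (y : ℚ_[p]) = (p : ℚ_[p]) ^ n * x := rfl
    rw [PadicInt.coe_sub, h3]
    push_cast
    field_simp
  rw [h2, norm_div, norm_pow, Padic.norm_p, inv_pow, div_inv_eq_mul,
    ← le_div_iff₀ (by have := hp.out.pos; positivity), one_div]
  rwa [zpow_neg, zpow_natCast] at h1

end QpZp

section H1

variable {G : Type*} [Group G] [TopologicalSpace G] {A : Type*} [AddCommGroup A]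

theorem H1.ext {χ ψ : H1 G A} (h : ∀ γ, χ.1 (Additive.ofMul γ) = ψ.1 (Additive.ofMul γ)) :
    χ = ψ := Subtype.ext (DFunLike.ext _ _ h)

theorem H1.apply_mul (χ : H1 G A) (γ τ : G) : χ.1 (Additive.ofMul (γ * τ)) =
    χ.1 (Additive.ofMul γ) + χ.1 (Additive.ofMul τ) := map_add χ.1 _ _

theorem isLocallyConstant_of_subgroup [ContinuousMul G] (χ : Additive G →+ A) (U : Subgroup G)
    (hU : IsOpen (U : Set G)) (h : ∀ g ∈ U, χ (Additive.ofMul g) = 0) :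
    IsLocallyConstant fun g : G => χ (Additive.ofMul g) := by
  rw [IsLocallyConstant.iff_exists_open]
  intro g
  refine ⟨(fun x => g⁻¹ * x) ⁻¹' U, hU.preimage (continuous_const_mul _), by simp, fun x hx => ?_⟩
  have h1 := h _ hx
  rw [ofMul_mul, map_add, ofMul_inv, map_neg, neg_add_eq_zero] at h1
  exact h1.symm

theorem H1.finite_range [CompactSpace G] (χ : H1 G A) :
    (Set.range fun g : G => χ.1 (Additive.ofMul g)).Finite := IsLocallyConstant.range_finite χ.2

/-- A locally constant function on a compact space takes finitely many values, each of them
`p`-power torsion. -/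
theorem H1.exists_pow_nsmul_eq_zero [CompactSpace G] (p : ℕ) [hp : Fact p.Prime]
    (χ : H1 G (QpZp p)) : ∃ n : ℕ, ∀ g, p ^ n • χ.1 (Additive.ofMul g) = 0 := by
  choose N hN using QpZp.exists_pow_nsmul_eq_zero p
  obtain ⟨M, hM⟩ := ((H1.finite_range χ).image N).bddAbove
  refine ⟨M, fun g => ?_⟩
  have h1 : N (χ.1 (Additive.ofMul g)) ≤ M := hM ⟨_, ⟨g, rfl⟩, rfl⟩
  rw [← Nat.sub_add_cancel h1, pow_add, mul_nsmul', hN, smul_zero]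

end H1

/-! ### The Artin-Schreier-Witt isomorphism -/

section ASW

variable (p : ℕ) [hp : Fact p.Prime] (κ : Type*) [Field κ] [CharP κ p]

/-- The polynomial `X ^ p - X - a` has derivative `-1`, so it is separable. -/
theorem exists_pow_sub_eq (K : Type*) [Field K] [CharP K p] [IsSepClosed K] (a : K) :
    ∃ b : K, b ^ p - b = a := by
  obtain ⟨b, hb⟩ := IsSepClosed.exists_root
    (Polynomial.X ^ p - (Polynomial.X + Polynomial.C a) : Polynomial K) (by
      rw [Polynomial.degree_sub_eq_left_of_degree_lt]
      · rw [Polynomial.degree_X_pow]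
        exact_mod_cast hp.out.ne_zero
      · rw [Polynomial.degree_X_pow, Polynomial.degree_X_add_C]
        exact_mod_cast hp.out.one_lt) (by
      have h : (Polynomial.X ^ p - (Polynomial.X + Polynomial.C a) : Polynomial K).derivative =
          -1 := by
        simp [Polynomial.derivative_X_pow]
      rw [Polynomial.separable_def, h]
      exact isCoprime_one_right.neg_right)
  refine ⟨b, ?_⟩
  rw [← sub_eq_zero, ← sub_add_eq_sub_sub]
  simpa only [Polynomial.IsRoot.def, Polynomial.eval_sub, Polynomial.eval_add,
    Polynomial.eval_pow, Polynomial.eval_X, Polynomial.eval_C] using hb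

theorem W.exists_frob_sub_of_isSepClosed (K : Type*) [Field K] [CharP K p] [IsSepClosed K] (m : ℕ)
    (x : W p m K) : ∃ y, W.frob p K m y - y = x := by
  -- The target `K ⧸ ⊤` is the zero ring, so the kernel condition is empty and every Witt vector
  -- qualifies.
  refine W.exists_frob_sub p (algebraMap K (K ⧸ (⊤ : Ideal K))) (fun a _ => ?_) m x
    ((W.map_eq_zero_iff p m _ _).2 fun i => Subsingleton.elim _ _)
  obtain ⟨b, hb⟩ := exists_pow_sub_eq p K a
  exact ⟨b, Subsingleton.elim _ _, hb⟩

theorem W.map_algEquiv_map_algebraMap {κ L : Type*} [Field κ] [Field L] [Algebra κ L] (m : ℕ)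
    (γ : L ≃ₐ[κ] L) (x : W p m κ) :
    W.map p m (γ : L →+* L) (W.map p m (algebraMap κ L) x) = W.map p m (algebraMap κ L) x := by
  rw [W.map_map]
  congr 1
  exact congrArg _ (RingHom.ext fun a => γ.commutes a)

theorem exists_isASW {m : ℕ} (x : W p m κ) : ∃ χ, IsASW p κ m x χ := by
  obtain ⟨ν, hν⟩ := W.exists_frob_sub_of_isSepClosed p (SeparableClosure κ) m
    (W.map p m (algebraMap κ (SeparableClosure κ)) x)
  have h1 : ∀ γ : Gsep κ, ∃ a : ℤ,
      W.map p m (γ : SeparableClosure κ →+* SeparableClosure κ) ν - ν = (a : W p m _) := by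
    intro γ
    -- `F` commutes with `γ`, and `F(ν) - ν` comes from `κ`, hence is fixed by `γ`; so `F` fixes
    -- `γ(ν) - ν`.
    refine W.exists_intCast_of_frob_eq p m _ ?_
    have h2 := W.map_algEquiv_map_algebraMap p m γ x
    rw [← hν, map_sub, W.map_frob] at h2
    rw [map_sub, sub_eq_sub_iff_sub_eq_sub, h2]
  choose a ha using h1
  -- The integers `a γ` are only determined modulo `p^{m+1}`. Additivity in `γ` holds at that
  -- precision because the integer `τ(ν) - ν` is fixed by `γ`.
  have h2 : ∀ γ τ, (p : ℤ) ^ (m + 1) ∣ a (γ * τ) - (a γ + a τ) := by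
    intro γ τ
    rw [← W.intCast_eq_zero_iff p (R := SeparableClosure κ) m]
    push_cast
    have h3 : W.map p m (γ : SeparableClosure κ →+* SeparableClosure κ)
        (W.map p m (τ : SeparableClosure κ →+* SeparableClosure κ) ν - ν) = a τ := by
      rw [ha, map_intCast]
    have h4 : W.map p m ((γ * τ : Gsep κ) : SeparableClosure κ →+* SeparableClosure κ) ν =
        W.map p m (γ : SeparableClosure κ →+* SeparableClosure κ)
          (W.map p m (τ : SeparableClosure κ →+* SeparableClosure κ) ν) := rfl
    rw [← h3, ← ha, ← ha, h4, map_sub]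
    ring
  let χ : Additive (Gsep κ) →+ QpZp p := AddMonoidHom.mk'
    (fun γ => QuotientAddGroup.mk ((a γ.toMul : ℚ_[p]) / (p : ℚ_[p]) ^ (m + 1)))
    (fun γ τ => by
      rw [← QuotientAddGroup.mk_add, ← add_div, ← Int.cast_add, QpZp.mk_div_eq_iff]
      exact h2 _ _)
  refine ⟨⟨χ, ?_⟩, ν, hν, fun γ => ⟨a γ, ha γ, rfl⟩⟩
  -- Continuity: the coefficients of `ν` generate a finite extension, and the open subgroup fixing
  -- it fixes `ν`, so `χ` vanishes there.
  let K : IntermediateField κ (SeparableClosure κ) :=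
    IntermediateField.adjoin κ (Set.range fun i => ν.coeff i)
  have : FiniteDimensional κ K := IntermediateField.finiteDimensional_adjoin
    fun y _ => (Algebra.IsSeparable.isIntegral κ y)
  refine isLocallyConstant_of_subgroup χ K.fixingSubgroup
    (IntermediateField.fixingSubgroup_isOpen K) fun γ hγ => ?_
  change QuotientAddGroup.mk _ = _
  rw [QpZp.mk_div_eq_zero_iff, ← W.intCast_eq_zero_iff p (R := SeparableClosure κ) m,
    toMul_ofMul, ← ha, sub_eq_zero]
  refine TruncatedWittVector.ext fun i => ?_
  rw [W.coeff_map]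
  exact (IntermediateField.mem_fixingSubgroup_iff _ _).1 hγ _
    (IntermediateField.subset_adjoin κ _ ⟨i, rfl⟩)

variable {κ}

theorem W.mem_range_map_of_fixed {κ L : Type*} [Field κ] [Field L] [Algebra κ L] [IsGalois κ L]
    (m : ℕ) (x : W p m L) (hx : ∀ γ : L ≃ₐ[κ] L, W.map p m (γ : L →+* L) x = x) :
    ∃ y, W.map p m (algebraMap κ L) y = x := by
  have h1 : ∀ i, ∃ b, algebraMap κ L b = x.coeff i := by
    intro i
    rw [← Set.mem_range, ← IntermediateField.mem_bot, InfiniteGalois.mem_bot_iff_fixed]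
    intro γ
    conv_rhs => rw [← hx γ]
    rfl
  choose b hb using h1
  refine ⟨TruncatedWittVector.mk p b, ?_⟩
  ext i
  rw [W.coeff_map, TruncatedWittVector.coeff_mk, hb]

/-- If the character vanishes, `ν` is Galois invariant and descends to `κ`, coefficient by
coefficient. This computes the kernel of `δ`. -/
theorem IsASW.zero_iff {m : ℕ} {x : W p m κ} :
    IsASW p κ m x 0 ↔ ∃ y, W.frob p κ m y - y = x := by
  constructor
  · rintro ⟨ν, hν, hγ⟩
    obtain ⟨y, rfl⟩ := W.mem_range_map_of_fixed p m ν fun γ => by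
      obtain ⟨a, ha, h0⟩ := hγ γ
      have h1 := (QpZp.mk_div_eq_zero_iff p (m + 1) a).1 h0.symm
      rw [← sub_eq_zero, ha, W.intCast_eq_zero_iff]
      exact h1
    refine ⟨y, W.map_injective p m (algebraMap κ (SeparableClosure κ)).injective ?_⟩
    rw [map_sub, W.map_frob, hν]
  · rintro ⟨y, rfl⟩
    refine ⟨W.map p m (algebraMap κ (SeparableClosure κ)) y, ?_, fun γ => ⟨0, ?_, ?_⟩⟩
    · rw [map_sub, W.map_frob]
    · rw [W.map_algEquiv_map_algebraMap, sub_self, Int.cast_zero]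
    · rw [Int.cast_zero, zero_div]
      rfl

/-- For `x = 0` the solution `ν` is fixed by `F`, hence an integer, hence Galois invariant. Applied
to differences, this gives the independence of `δ` from all choices. -/
theorem IsASW.eq_zero {m : ℕ} {χ : H1 (Gsep κ) (QpZp p)} (h : IsASW p κ m 0 χ) : χ = 0 := by
  obtain ⟨ν, hν, hγ⟩ := h
  rw [map_zero, sub_eq_zero] at hν
  obtain ⟨b, rfl⟩ := W.exists_intCast_of_frob_eq p m ν hν
  refine H1.ext fun γ => ?_
  obtain ⟨a, ha, h⟩ := hγ γ
  rw [map_intCast, sub_self] at ha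
  rw [h]
  exact (QpZp.mk_div_eq_zero_iff p _ a).2 ((W.intCast_eq_zero_iff p m a).1 ha.symm)

theorem exists_mem_aswGraph (f : CW p κ) : ∃ χ, (f, χ) ∈ aswGraph p κ := by
  obtain ⟨m, x, rfl⟩ := CW.exists_of p f
  obtain ⟨χ, h⟩ := exists_isASW p κ x
  exact ⟨χ, m, x, rfl, h⟩

theorem aswGraph_unique {f : CW p κ} {χ ψ : H1 (Gsep κ) (QpZp p)} (hχ : (f, χ) ∈ aswGraph p κ)
    (hψ : (f, ψ) ∈ aswGraph p κ) : χ = ψ := by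
  obtain ⟨m, x, hx, h⟩ := (aswGraph p κ).sub_mem hχ hψ
  have hx : CW.of p κ m x = CW.of p κ m 0 := by
    rw [hx, map_zero]
    exact sub_self f
  rw [CW.of_injective p κ m hx] at h
  exact sub_eq_zero.1 h.eq_zero

theorem mem_aswGraph_zero_iff (f : CW p κ) : (f, 0) ∈ aswGraph p κ ↔ f ∈ CW.asw p κ := by
  rw [CW.mem_asw]
  constructor
  · rintro ⟨m, x, rfl, h⟩
    obtain ⟨y, rfl⟩ := (IsASW.zero_iff p).1 h
    exact ⟨CW.of p κ m y, by rw [CW.frob_of, ← map_sub]⟩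
  · rintro ⟨y, rfl⟩
    obtain ⟨m, y, rfl⟩ := CW.exists_of p y
    exact ⟨m, _, by rw [CW.frob_of, ← map_sub], (IsASW.zero_iff p).2 ⟨y, rfl⟩⟩

/-- Choose `b` of trace `1` in `L/κ`. The trace `T` of its Teichmüller representative has zeroth
coefficient `1`, so it is a unit, and it is Galois invariant; dividing by it normalises the trace to
`1`. -/
theorem W.exists_sum_eq_one {κ : Type*} [Field κ] (L : Type*) [Field L] [Algebra κ L]
    [FiniteDimensional κ L] [IsGalois κ L] [CharP L p] (m : ℕ) :
    ∃ c : W p m L, ∑ σ : L ≃ₐ[κ] L, W.map p m (σ : L →+* L) c = 1 := by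
  obtain ⟨b, hb⟩ := Algebra.trace_surjective κ L 1
  let T : WittVector p L :=
    ∑ σ : L ≃ₐ[κ] L, WittVector.map (σ : L →+* L) (WittVector.teichmuller p b)
  have hT : IsUnit T := by
    apply WittVector.isUnit_of_coeff_zero_ne_zero
    have h1 : T.coeff 0 = 1 := by
      change WittVector.constantCoeff T = 1
      rw [map_sum, ← map_one (algebraMap κ L), ← hb, trace_eq_sum_automorphisms]
      exact Finset.sum_congr rfl fun σ _ => by
        simp [WittVector.constantCoeff_apply]
    rw [h1]
    exact one_ne_zero
  obtain ⟨u, hu⟩ := hT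
  have hσ : ∀ σ : L ≃ₐ[κ] L, WittVector.map (σ : L →+* L) T = T := by
    intro σ
    rw [map_sum]
    refine Fintype.sum_equiv (Equiv.mulLeft σ) _ _ fun τ => ?_
    rfl
  have hσ' : ∀ σ : L ≃ₐ[κ] L, WittVector.map (σ : L →+* L) (↑u⁻¹ : WittVector p L) = ↑u⁻¹ := by
    intro σ
    rw [← Units.mul_eq_one_iff_eq_inv, hu]
    rw [← hσ σ, ← map_mul, ← hu, Units.inv_mul, map_one]
  refine ⟨WittVector.truncate (m + 1) (↑u⁻¹ * WittVector.teichmuller p b), ?_⟩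
  simp only [W.map_truncate, map_mul, hσ']
  rw [← Finset.mul_sum, ← map_sum, ← map_mul, ← map_one (WittVector.truncate (m + 1))]
  congr 1
  change ↑u⁻¹ * T = 1
  rw [← hu, Units.inv_mul]

/-- The additive form of Hilbert's theorem 90 for Witt vectors and homomorphisms. -/
theorem W.exists_map_sub_eq {κ : Type*} [Field κ] (L : Type*) [Field L] [Algebra κ L]
    [FiniteDimensional κ L] [IsGalois κ L] [CharP L p] (m : ℕ) (c : (L ≃ₐ[κ] L) → ℤ)
    (hc : ∀ σ τ, (c (σ * τ) : W p m L) = c σ + c τ) :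
    ∃ ν : W p m L, ∀ τ : L ≃ₐ[κ] L, W.map p m (τ : L →+* L) ν - ν = c τ := by
  obtain ⟨b, hb⟩ := W.exists_sum_eq_one p (κ := κ) L m
  -- Write `S` for the sum. Reindexing by `σ ↦ τ σ` turns `τ(S)` into `S - c τ`, since `b` has trace
  -- `1`; the sign converts this into `τ(ν) - ν = c τ`.
  refine ⟨-∑ σ : L ≃ₐ[κ] L, (c σ : W p m L) * W.map p m (σ : L →+* L) b, fun τ => ?_⟩
  have h1 : W.map p m (τ : L →+* L) (∑ σ : L ≃ₐ[κ] L, (c σ : W p m L) * W.map p m (σ : L →+* L) b) =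
      ∑ σ : L ≃ₐ[κ] L, ((c σ : W p m L) - c τ) * W.map p m (σ : L →+* L) b := by
    rw [map_sum]
    refine Fintype.sum_equiv (Equiv.mulLeft τ) _ _ fun σ => ?_
    rw [map_mul, map_intCast, Equiv.coe_mulLeft, hc, add_sub_cancel_left]
    rfl
  rw [map_neg, h1]
  simp only [sub_mul, Finset.sum_sub_distrib, ← Finset.mul_sum, hb]
  ring

theorem exists_isASW_of_char (χ : H1 (Gsep κ) (QpZp p)) : ∃ m x, IsASW p κ m x χ := by
  obtain ⟨m, hm⟩ := H1.exists_pow_nsmul_eq_zero p χ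
  have h1 : ∀ γ : Gsep κ, ∃ a : ℤ,
      χ.1 (Additive.ofMul γ) = QuotientAddGroup.mk ((a : ℚ_[p]) / (p : ℚ_[p]) ^ (m + 1)) :=
    -- The exponent is raised from `m` to `m + 1`, since `W p m` has length `m + 1`.
    fun γ => QpZp.exists_int_of_pow_nsmul_eq_zero p (m + 1) _ (by
      rw [pow_succ, mul_nsmul, hm, smul_zero])
  choose a ha using h1
  have h0 : {γ : Gsep κ | χ.1 (Additive.ofMul γ) = 0} ∈ nhds (1 : Gsep κ) :=
    (χ.2.isOpen_fiber 0).mem_nhds (map_zero χ.1)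
  rw [InfiniteGalois.krullTopology_mem_nhds_one_iff_of_isGalois] at h0
  obtain ⟨L, hL⟩ := h0
  let r : Gsep κ →* (L ≃ₐ[κ] L) := AlgEquiv.restrictNormalHom L
  have hr : ∀ (γ : Gsep κ) (y : L), algebraMap L (SeparableClosure κ) (r γ y) =
      γ (algebraMap L _ y) :=
    fun γ y => AlgEquiv.restrictNormal_commutes γ L y
  have hrs : Function.Surjective r := AlgEquiv.restrictNormalHom_surjective (SeparableClosure κ)
  -- Congruence modulo `p^{m+1}` reads the same in `W p m K`, for `K = L` or `K = κ^sep`, and in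
  -- `ℚ_p/ℤ_p`. Cocycle identities for `χ` can thus be moved between these groups.
  have hcast : ∀ (K : Type _) [Field K] [CharP K p] (u v : ℤ), (u : W p m K) = v ↔
      (QuotientAddGroup.mk ((u : ℚ_[p]) / (p : ℚ_[p]) ^ (m + 1)) : QpZp p) =
        QuotientAddGroup.mk ((v : ℚ_[p]) / (p : ℚ_[p]) ^ (m + 1)) := by
    intro K _ _ u v
    rw [QpZp.mk_div_eq_iff, ← W.intCast_eq_zero_iff p (R := K) m, Int.cast_sub, sub_eq_zero]
  -- `χ` factors through the finite group `Gal(L/κ)`, where Hilbert 90 applies.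
  have hker : ∀ γ τ : Gsep κ, r γ = r τ → χ.1 (Additive.ofMul γ) = χ.1 (Additive.ofMul τ) := by
    intro γ τ h
    have h2 : τ⁻¹ * γ ∈ L.toIntermediateField.fixingSubgroup := by
      rw [IntermediateField.mem_fixingSubgroup_iff]
      intro y hy
      have h3 := hr γ ⟨y, hy⟩
      rw [h, hr] at h3
      change τ.symm (γ y) = y
      rw [AlgEquiv.symm_apply_eq]
      exact h3.symm
    have h3 : χ.1 (Additive.ofMul (τ⁻¹ * γ)) = 0 := hL h2
    rw [H1.apply_mul, ofMul_inv, map_neg, neg_add_eq_zero] at h3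
    exact h3.symm
  have : CharP L p := charP_of_injective_algebraMap (algebraMap κ L).injective p
  choose s hs using hrs
  obtain ⟨ν, hν⟩ := W.exists_map_sub_eq p (κ := κ) L m (fun σ => a (s σ)) (fun σ τ => by
    rw [← Int.cast_add, hcast, Int.cast_add, add_div, QuotientAddGroup.mk_add, ← ha, ← ha, ← ha,
      ← H1.apply_mul]
    exact hker _ _ (by rw [map_mul, hs, hs, hs]))
  let ι : L →+* SeparableClosure κ := algebraMap L (SeparableClosure κ)
  have hν' : ∀ γ : Gsep κ,
      W.map p m (γ : SeparableClosure κ →+* SeparableClosure κ) (W.map p m ι ν) -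
        W.map p m ι ν = (a γ : W p m _) := by
    intro γ
    have h2 : (a γ : W p m (SeparableClosure κ)) = a (s (r γ)) := by
      rw [hcast, ← ha, ← ha]
      exact hker _ _ (hs _).symm
    rw [h2, ← map_intCast (W.map p m ι), ← hν, map_sub]
    congr 1
    refine TruncatedWittVector.ext fun i => ?_
    exact (hr γ (ν.coeff i)).symm
  -- `γ(ν) - ν` is an integer, hence fixed by `F`. This says precisely that `F(ν) - ν` is fixed by
  -- `γ`.
  obtain ⟨x, hx⟩ := W.mem_range_map_of_fixed p (κ := κ) m
    (W.frob p _ m (W.map p m ι ν) - W.map p m ι ν) (fun γ => by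
      have h2 := congrArg (W.frob p _ m) (hν' γ)
      rw [map_sub, map_intCast, ← W.map_frob, ← hν' γ, sub_eq_sub_iff_sub_eq_sub] at h2
      rw [map_sub, h2])
  exact ⟨m, x, W.map p m ι ν, hx.symm, fun γ => ⟨a γ, hν' γ, ha γ⟩⟩

variable (κ) in
/-- The Artin-Schreier-Witt morphism. -/
def aswHom : CW p κ →+ H1 (Gsep κ) (QpZp p) :=
  AddMonoidHom.mk' (fun f => (exists_mem_aswGraph p f).choose) fun f g =>
    aswGraph_unique p (exists_mem_aswGraph p (f + g)).choose_spec
      ((aswGraph p κ).add_mem (exists_mem_aswGraph p f).choose_spec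
        (exists_mem_aswGraph p g).choose_spec)

theorem mem_aswGraph_iff (f : CW p κ) (χ : H1 (Gsep κ) (QpZp p)) :
    (f, χ) ∈ aswGraph p κ ↔ aswHom p κ f = χ := by
  have h : (f, aswHom p κ f) ∈ aswGraph p κ := (exists_mem_aswGraph p f).choose_spec
  exact ⟨fun h' => aswGraph_unique p h h', fun h' => h' ▸ h⟩

theorem aswHom_surjective : Function.Surjective (aswHom p κ) := by
  intro χ
  obtain ⟨m, x, h⟩ := exists_isASW_of_char p χ
  exact ⟨CW.of p κ m x, (mem_aswGraph_iff p _ _).1 ⟨m, x, rfl, h⟩⟩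

theorem ker_aswHom : (aswHom p κ).ker = CW.asw p κ := by
  ext f
  rw [AddMonoidHom.mem_ker, ← mem_aswGraph_iff, mem_aswGraph_zero_iff]

variable (κ) in
/-- The Artin-Schreier-Witt isomorphism. -/
def aswEquiv : (CW p κ ⧸ CW.asw p κ) ≃+ H1 (Gsep κ) (QpZp p) :=
  (QuotientAddGroup.quotientAddEquivOfEq (ker_aswHom p).symm).trans
    (QuotientAddGroup.quotientKerEquivOfSurjective (aswHom p κ) (aswHom_surjective p))

theorem aswEquiv_mk (f : CW p κ) : aswEquiv p κ (QuotientAddGroup.mk f) = aswHom p κ f := rfl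

end ASW

/-! ### Leading coefficients of Witt vectors over `k((t))` -/

section Leading

variable (p : ℕ) [hp : Fact p.Prime] {k : Type*} [Field k] [CharP k p]

/-- The substitution `t ↦ t ^ N` in Laurent series. -/
def powSubst (k : Type*) [Field k] (N : ℕ) (hN : 0 < N) : LaurentSeries k →+* LaurentSeries k :=
  HahnSeries.embDomainRingHom (AddMonoidHom.mulLeft (N : ℤ))
    (mul_right_injective₀ (by exact_mod_cast hN.ne'))
    fun _ _ => mul_le_mul_iff_right₀ (by exact_mod_cast hN)

theorem powSubst_coeff_mul (N : ℕ) (hN : 0 < N) (a : LaurentSeries k) (j : ℤ) :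
    (powSubst k N hN a).coeff (N * j) = a.coeff j :=
  HahnSeries.embDomain_coeff (a := j)

theorem powSubst_coeff_of_not_dvd (N : ℕ) (hN : 0 < N) (a : LaurentSeries k) (j : ℤ)
    (hj : ¬ (N : ℤ) ∣ j) : (powSubst k N hN a).coeff j = 0 :=
  HahnSeries.embDomain_of_notMem_range (by
    rintro ⟨i, rfl⟩
    exact hj ⟨i, rfl⟩)

theorem exists_ofPowerSeries_eq (a : LaurentSeries k) (ha : ∀ j < 0, a.coeff j = 0) :
    ∃ b, HahnSeries.ofPowerSeries ℤ k b = a := by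
  refine ⟨PowerSeries.mk fun n => a.coeff n, ?_⟩
  ext j
  rcases lt_or_ge j 0 with hj | hj
  · rw [ha j hj, HahnSeries.ofPowerSeries_apply, HahnSeries.embDomain_of_notMem_range]
    rintro ⟨n, rfl⟩
    exact absurd hj (not_lt.2 (Int.natCast_nonneg n))
  · obtain ⟨n, rfl⟩ := Int.eq_ofNat_of_zero_le hj
    exact (HahnSeries.ofPowerSeries_apply_coeff _ n).trans (PowerSeries.coeff_mk _ _)

theorem ofPowerSeries_coeff_neg (b : PowerSeries k) (j : ℤ) (hj : j < 0) :
    (HahnSeries.ofPowerSeries ℤ k b).coeff j = 0 := by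
  rw [HahnSeries.ofPowerSeries_apply, HahnSeries.embDomain_of_notMem_range]
  rintro ⟨n, rfl⟩
  exact absurd hj (not_lt.2 (Int.natCast_nonneg n))

/-- Stating the condition through vanishing coefficients avoids the junk order of the zero series.
-/
theorem W.mem_fil_iff (m d : ℕ) (x : W p m (LaurentSeries k)) : x ∈ W.fil p k m d ↔
    ∀ (i : Fin (m + 1)) (j : ℤ), (p : ℤ) ^ (m - (i : ℕ)) * j < -d → (x.coeff i).coeff j = 0 := by
  change _ ≤ W.val p k m x ↔ _
  rw [W.neg_le_val_iff]
  refine forall_congr' fun i => ?_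
  have hp0 : (0 : ℤ) < (p : ℤ) ^ (m - (i : ℕ)) := pow_pos (by exact_mod_cast hp.out.pos) _
  constructor
  · rintro (h | h) j hj
    · rw [h, HahnSeries.coeff_zero]
    · exact HahnSeries.coeff_eq_zero_of_lt_order (lt_of_mul_lt_mul_left (hj.trans_le h) hp0.le)
  · intro h
    by_contra! h'
    exact HahnSeries.coeff_order_eq_zero.not.2 h'.1 (h _ h'.2)

theorem W.fil_mono (m : ℕ) {d e : ℕ} (h : d ≤ e) : W.fil p k m d ≤ W.fil p k m e := by
  intro x hx
  rw [W.mem_fil_iff] at hx ⊢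
  exact fun i j hj => hx i j (by omega)

/-- Multiplication by a Teichmüller representative multiplies the coefficients by powers. -/
theorem W.coeff_teichmuller_mul {R : Type*} [CommRing R] [CharP R p] (m : ℕ) (u : R) (x : W p m R)
    (i : Fin (m + 1)) :
    ((WittVector.truncate (m + 1) (WittVector.teichmuller p u) : W p m R) * x).coeff i =
      u ^ p ^ (i : ℕ) * x.coeff i := by
  obtain ⟨x, rfl⟩ := WittVector.truncate_surjective p (m + 1) R x
  rw [← map_mul, WittVector.coeff_truncate, WittVector.coeff_truncate,
    KatoSwan.coeff_teichmuller_mul]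

/-- The leading coefficients, in degree `-d`, of the elements of `Fil_d(W_m(k((t))))`. -/
theorem W.exists_leading (m d : ℕ) : ∃ L : W.fil p k m d →+ W p m k,
    ∀ (x : W.fil p k m d) (i : Fin (m + 1)),
      (∀ e : ℕ, p ^ (m - (i : ℕ)) * e = d → (L x).coeff i = (x.1.coeff i).coeff (-e)) ∧
      (¬ p ^ (m - (i : ℕ)) ∣ d → (L x).coeff i = 0) := by
  -- The `i`-th coefficient of `T * f(x)` is `t ^ (pⁱ d) * x_i(t ^ pᵐ)`, which is integral exactly
  -- when `p^{m-i} v(x_i) ≥ -d`. Its constant term is the coefficient of `x_i` in degree `-d /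
  -- p^{m-i}`, or zero if this is not an integer. The substitution avoids fractional powers of `t`.
  have hN : 0 < p ^ m := pow_pos hp.out.pos m
  let f := powSubst k (p ^ m) hN
  let u : LaurentSeries k := HahnSeries.single (d : ℤ) 1
  let T : W p m (LaurentSeries k) := WittVector.truncate (m + 1) (WittVector.teichmuller p u)
  let ι : PowerSeries k →+* LaurentSeries k := HahnSeries.ofPowerSeries ℤ k
  have hι : Function.Injective ι := HahnSeries.ofPowerSeries_injective
  have hT : ∀ (x : W p m (LaurentSeries k)) (i : Fin (m + 1)) (j : ℤ),
      ((T * W.map p m f x).coeff i).coeff j =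
        (f (x.coeff i)).coeff (j - ((p ^ (i : ℕ) * d : ℕ) : ℤ)) := by
    intro x i j
    rw [W.coeff_teichmuller_mul, HahnSeries.single_pow, one_pow, HahnSeries.coeff_single_mul,
      one_mul, W.coeff_map, nsmul_eq_mul, ← Nat.cast_mul]
  have hp0 : (0 : ℤ) < p := by exact_mod_cast hp.out.pos
  have hint : ∀ x : W.fil p k m d, ∃ y, W.map p m ι y = T * W.map p m f x.1 := by
    intro x
    have h1 : ∀ i, ∃ b, ι b = (T * W.map p m f x.1).coeff i := fun i =>
      exists_ofPowerSeries_eq _ fun j hj => by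
        rw [hT]
        by_cases hd : ((p ^ m : ℕ) : ℤ) ∣ j - ((p ^ (i : ℕ) * d : ℕ) : ℤ)
        · obtain ⟨l, hl⟩ := hd
          rw [hl, powSubst_coeff_mul]
          refine (W.mem_fil_iff p m d x.1).1 x.2 i l ?_
          have h2 : (p : ℤ) ^ (i : ℕ) * ((p : ℤ) ^ (m - (i : ℕ)) * l) < (p : ℤ) ^ (i : ℕ) * -d := by
            rw [← mul_assoc, ← pow_add, Nat.add_sub_cancel' (Nat.lt_succ_iff.1 i.2)]
            push_cast at hl
            linarith
          exact lt_of_mul_lt_mul_left h2 (pow_pos hp0 _).le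
        · exact powSubst_coeff_of_not_dvd _ _ _ _ hd
    choose b hb using h1
    refine ⟨TruncatedWittVector.mk p b, ?_⟩
    refine TruncatedWittVector.ext fun i => ?_
    rw [W.coeff_map, TruncatedWittVector.coeff_mk, hb]
  choose y hy using hint
  let Y : W.fil p k m d →+ W p m (PowerSeries k) := AddMonoidHom.mk' y fun a b => by
    apply W.map_injective p m hι
    rw [map_add, hy, hy, hy, ← mul_add, ← map_add]
    rfl
  have hY : ∀ x i, (W.map p m (PowerSeries.constantCoeff (R := k)) (y x)).coeff i =
      (f (x.1.coeff i)).coeff (-((p ^ (i : ℕ) * d : ℕ) : ℤ)) := by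
    intro x i
    rw [W.coeff_map, ← zero_sub, ← hT, ← hy, W.coeff_map]
    have h1 := HahnSeries.ofPowerSeries_apply_coeff (Γ := ℤ) ((y x).coeff i) 0
    rw [PowerSeries.coeff_zero_eq_constantCoeff_apply, Nat.cast_zero] at h1
    exact h1.symm
  refine ⟨(W.map p m (PowerSeries.constantCoeff (R := k)) : _ →+ _).comp Y, fun x i =>
    ⟨fun e he => ?_, fun hd => ?_⟩⟩
  · refine (hY x i).trans ?_
    rw [← powSubst_coeff_mul (p ^ m) hN (x.1.coeff i) (-e)]
    refine congrArg (f (x.1.coeff i)).coeff ?_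
    have h1 : p ^ (i : ℕ) * d = p ^ m * e := by
      rw [← he, ← mul_assoc, ← pow_add, Nat.add_sub_cancel' (Nat.lt_succ_iff.1 i.2)]
    rw [h1]
    push_cast
    ring
  · refine (hY x i).trans (powSubst_coeff_of_not_dvd _ _ _ _ fun h => hd ?_)
    rw [dvd_neg, Int.natCast_dvd_natCast] at h
    refine Nat.dvd_of_mul_dvd_mul_left (pow_pos hp.out.pos (i : ℕ)) ?_
    rwa [← pow_add, Nat.add_sub_cancel' (Nat.lt_succ_iff.1 i.2)]

/-- `Fil_{d+1}` allows only one more weighted degree than `Fil_d`, namely `p^{m-i} j = -(d + 1)`,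
and those coefficients are assumed to vanish. -/
theorem W.mem_fil_of_leading_eq_zero (m d : ℕ) (x : W p m (LaurentSeries k))
    (hx : x ∈ W.fil p k m (d + 1))
    (h : ∀ (i : Fin (m + 1)) (e : ℕ), p ^ (m - (i : ℕ)) * e = d + 1 →
      (x.coeff i).coeff (-e) = 0) : x ∈ W.fil p k m d := by
  rw [W.mem_fil_iff] at hx ⊢
  intro i j hj
  rcases lt_or_eq_of_le (show (p : ℤ) ^ (m - (i : ℕ)) * j ≤ -(d + 1 : ℕ) by push_cast; omega)
    with h1 | h1
  · exact hx i j h1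
  · have hp0 : (0 : ℤ) < (p : ℤ) ^ (m - (i : ℕ)) := pow_pos (by exact_mod_cast hp.out.pos) _
    have hj0 : j ≤ 0 := by
      by_contra! hj0
      have := mul_pos hp0 hj0
      push_cast at h1
      omega
    obtain ⟨e, he⟩ := Int.eq_ofNat_of_zero_le (neg_nonneg.2 hj0)
    obtain rfl : j = -e := by omega
    refine h i e ?_
    push_cast at h1
    zify
    linarith

variable (k) in
/-- The additive map `λ ↦ (λ₀ t⁻ⁿ, …, λₘ t^{-npᵐ})`. -/
def W.monomial (n m : ℕ) : W p m k →+ W p m (LaurentSeries k) :=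
  (AddMonoidHom.mulLeft (WittVector.truncate (m + 1)
    (WittVector.teichmuller p (HahnSeries.single (-(n : ℤ)) 1)) : W p m (LaurentSeries k))).comp
    (W.map p m (HahnSeries.C : k →+* LaurentSeries k) : W p m k →+ W p m (LaurentSeries k))

theorem W.coeff_monomial (n m : ℕ) (x : W p m k) (i : Fin (m + 1)) :
    (W.monomial p k n m x).coeff i =
      HahnSeries.single (-((n * p ^ (i : ℕ) : ℕ) : ℤ)) (x.coeff i) := by
  refine (W.coeff_teichmuller_mul p m (HahnSeries.single (-(n : ℤ)) 1 : LaurentSeries k) _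
    i).trans ?_
  change _ * HahnSeries.C (x.coeff i) = _
  rw [HahnSeries.single_pow, one_pow, HahnSeries.C_apply, HahnSeries.single_mul_single,
    add_zero, one_mul]
  refine congrArg (fun j => HahnSeries.single j (x.coeff i)) ?_
  rw [nsmul_eq_mul]
  push_cast
  ring

variable (k) in
/-- The co-monomial `λ t^{-npᵐ}` as an additive function of `λ`. -/
def comonomialHom (n m : ℕ) : W p m k →+ CW p (LaurentSeries k) :=
  (CW.of p _ m).comp (W.monomial p k n m)

/-- Defined as a product with a Teichmüller representative, the monomial is additive in `λ` for
free; this identifies it with the coordinate formula. -/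
theorem comonomialHom_apply (n m : ℕ) (x : W p m k) :
    comonomialHom p k n m x = comonomial p k n m x := by
  refine congrArg (CW.of p _ m) (TruncatedWittVector.ext fun i => ?_)
  rw [W.coeff_monomial, TruncatedWittVector.coeff_mk]

theorem W.monomial_mem_fil (n m : ℕ) (x : W p m k) :
    W.monomial p k n m x ∈ W.fil p k m (n * p ^ m) := by
  rw [W.mem_fil_iff]
  intro i j hj
  rw [W.coeff_monomial]
  refine HahnSeries.coeff_single_of_ne ?_
  rintro rfl
  refine hj.ne ?_
  have h1 : p ^ m = p ^ (m - (i : ℕ)) * p ^ (i : ℕ) := by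
    rw [← pow_add, Nat.sub_add_cancel (Nat.lt_succ_iff.1 i.2)]
  rw [h1]
  push_cast
  ring

theorem comonomialHom_mem_fil (n m : ℕ) (x : W p m k) :
    comonomialHom p k n m x ∈ CW.fil p k (n * p ^ m) :=
  ⟨m, _, W.monomial_mem_fil p n m x, rfl⟩

theorem CW.fil_mono {d e : ℕ} (h : d ≤ e) : CW.fil p k d ≤ CW.fil p k e := by
  rintro _ ⟨m, x, hx, rfl⟩
  exact ⟨m, x, W.fil_mono p m h hx, rfl⟩

theorem CW.exists_mem_fil (f : CW p (LaurentSeries k)) : ∃ d, f ∈ CW.fil p k d := by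
  obtain ⟨m, x, rfl⟩ := CW.exists_of p f
  -- A crude bound: the sum dominates each weighted pole order.
  refine ⟨∑ i : Fin (m + 1), p ^ (m - (i : ℕ)) * (x.coeff i).order.natAbs, m, x, ?_, rfl⟩
  refine (W.neg_le_val_iff p m _ x).2 fun i => Or.inr ?_
  have h1 := Finset.single_le_sum (f := fun i : Fin (m + 1) =>
    p ^ (m - (i : ℕ)) * (x.coeff i).order.natAbs) (fun _ _ => Nat.zero_le _) (Finset.mem_univ i)
  have h2 : -(((x.coeff i).order.natAbs : ℕ) : ℤ) ≤ (x.coeff i).order := by omega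
  have h3 := mul_le_mul_of_nonneg_left h2 (show (0 : ℤ) ≤ (p : ℤ) ^ (m - (i : ℕ)) by positivity)
  refine le_trans ?_ h3
  rw [mul_neg, neg_le_neg_iff]
  exact_mod_cast h1

theorem W.coeff_shift_add (R : Type*) [CommRing R] (i j : ℕ) (h : i ≤ j) (x : W p i R)
    (l : Fin (i + 1)) : (W.shift p R i j h x).coeff ⟨l + (j - i), by omega⟩ = x.coeff l := by
  rw [W.coeff_shift, if_neg (by simp)]
  simp

/-- Every nonzero coefficient of the co-monomial has weighted degree exactly `-n pᵐ`, below `-d`, so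
none can occur. Shifts to a common length are injective and preserve weights. -/
theorem comonomialHom_eq_zero_of_mem {n m d : ℕ} (hd : d < n * p ^ m) (x : W p m k)
    (hx : comonomialHom p k n m x ∈ CW.fil p k d) : x = 0 := by
  obtain ⟨M, y, hy, h⟩ := hx
  have h1 : W.shift p _ m _ (le_max_right M m) (W.monomial p k n m x) =
      W.shift p _ M _ (le_max_left M m) y := by
    apply CW.of_injective p
    rw [CW.of_shift, CW.of_shift]
    exact h.symm
  have h2 := W.shift_mem_fil p k (le_max_left M m) hy
  rw [← h1, W.mem_fil_iff] at h2
  ext l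
  have h3 := h2 ⟨l + (max M m - m), by omega⟩ (-((n * p ^ (l : ℕ) : ℕ) : ℤ)) ?_
  · rwa [W.coeff_shift_add, W.coeff_monomial, HahnSeries.coeff_single_same,
      ← TruncatedWittVector.coeff_zero p (m + 1) k l] at h3
  · have h4 : max M m - (l + (max M m - m)) = m - l := by omega
    have h5 : p ^ m = p ^ (m - (l : ℕ)) * p ^ (l : ℕ) := by
      rw [← pow_add, Nat.sub_add_cancel (Nat.lt_succ_iff.1 l.2)]
    simp only [h4]
    zify at hd h5
    rw [h5] at hd
    push_cast
    linarith

/-- The leading vector of `f` is read off as some `x ∈ W_m(k)`; the co-monomial of `x` has the same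
leading vector, so subtracting it lowers the pole order. -/
theorem exists_sub_comonomialHom_mem {n m d : ℕ} (hn : n.Coprime p) (hd : d + 1 = n * p ^ m)
    (f : CW p (LaurentSeries k)) (hf : f ∈ CW.fil p k (d + 1)) :
    ∃ x, f - comonomialHom p k n m x ∈ CW.fil p k d := by
  obtain ⟨M₀, y₀, hy₀, rfl⟩ := hf
  rw [← CW.of_shift p _ M₀ (max M₀ m) (le_max_left _ _)]
  replace hy₀ := W.shift_mem_fil p k (le_max_left M₀ m) hy₀
  -- From here on `f` is represented in some length `M + 1` with `M ≥ m`.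
  generalize W.shift p _ M₀ (max M₀ m) (le_max_left _ _) y₀ = y at hy₀ ⊢
  have hM := le_max_right M₀ m
  generalize max M₀ m = M at y hy₀ hM ⊢
  obtain ⟨L, hL⟩ := W.exists_leading p (k := k) M (d + 1)
  obtain ⟨x, hx⟩ := W.exists_shift_of_coeff_zero p k hM (L ⟨y, hy₀⟩) fun l hl =>
    -- In the places `l < M - m` the exponent `M - l` is at least `m + 1`, and `p^{m+1}` does not
    -- divide `n pᵐ`; so the leading vector vanishes there and is a shift from length `m + 1`.
    (hL ⟨y, hy₀⟩ l).2 fun hdvd => by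
      have h1 : p ^ (m + 1) ∣ n * p ^ m := hd ▸ (pow_dvd_pow p (by omega)).trans hdvd
      rw [pow_succ', Nat.mul_dvd_mul_iff_right (pow_pos hp.out.pos m)] at h1
      exact hp.out.one_lt.ne' (Nat.Coprime.eq_one_of_dvd hn.symm h1)
  have hz : W.shift p _ m M hM (W.monomial p k n m x) ∈ W.fil p k M (d + 1) :=
    W.shift_mem_fil p k hM (hd ▸ W.monomial_mem_fil p n m x)
  have hLz : L ⟨_, hz⟩ = L ⟨y, hy₀⟩ := by
    rw [← hx]
    refine TruncatedWittVector.ext fun l => ?_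
    by_cases hl : (l : ℕ) < M - m
    · rw [W.coeff_shift, if_pos hl]
      by_cases hdvd : p ^ (M - (l : ℕ)) ∣ d + 1
      · obtain ⟨e, he⟩ := hdvd
        rw [(hL ⟨_, hz⟩ l).1 e he.symm, W.coeff_shift, if_pos hl, HahnSeries.coeff_zero]
      · exact (hL ⟨_, hz⟩ l).2 hdvd
    · obtain ⟨i, hi⟩ : ∃ i : Fin (m + 1), l = ⟨i + (M - m), by omega⟩ :=
        ⟨⟨l - (M - m), by omega⟩, by ext; simp only; omega⟩
      rw [hi, W.coeff_shift_add, (hL ⟨_, hz⟩ _).1 (n * p ^ (i : ℕ)), W.coeff_shift_add,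
        W.coeff_monomial, HahnSeries.coeff_single_same]
      have h4 : M - (i + (M - m)) = m - i := by omega
      have h5 : p ^ m = p ^ (m - (i : ℕ)) * p ^ (i : ℕ) := by
        rw [← pow_add, Nat.sub_add_cancel (Nat.lt_succ_iff.1 i.2)]
      simp only [h4]
      rw [hd, h5]
      ring
  -- The coefficients of a difference of Witt vectors are not differences of coefficients;
  -- additivity of `L` is indispensable here.
  have hL0 : L (⟨y, hy₀⟩ - ⟨_, hz⟩) = 0 := by rw [map_sub, hLz, sub_self]
  refine ⟨x, M, y - W.shift p _ m M hM (W.monomial p k n m x), ?_, ?_⟩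
  · refine W.mem_fil_of_leading_eq_zero p M d _ (sub_mem hy₀ hz) fun i e he => ?_
    have h1 := (hL (⟨y, hy₀⟩ - ⟨_, hz⟩) i).1 e he
    rw [hL0, TruncatedWittVector.coeff_zero] at h1
    exact h1.symm
  · rw [map_sub, CW.of_shift]
    rfl

theorem CW.mem_fil_zero_iff (f : CW p (LaurentSeries k)) : f ∈ CW.fil p k 0 ↔
    ∃ g, CW.map p (HahnSeries.ofPowerSeries ℤ k) g = f := by
  constructor
  · rintro ⟨m, x, hx, rfl⟩
    rw [W.mem_fil_iff] at hx
    have h1 : ∀ i, ∃ b, HahnSeries.ofPowerSeries ℤ k b = x.coeff i := fun i =>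
      exists_ofPowerSeries_eq _ fun j hj => hx i j (by
        rw [Nat.cast_zero, neg_zero]
        exact mul_neg_of_pos_of_neg (pow_pos (by exact_mod_cast hp.out.pos) _) hj)
    choose b hb using h1
    refine ⟨CW.of p _ m (TruncatedWittVector.mk p b), ?_⟩
    rw [CW.map_of]
    refine congrArg (CW.of p _ m) (TruncatedWittVector.ext fun i => ?_)
    rw [W.coeff_map, TruncatedWittVector.coeff_mk, hb]
  · rintro ⟨g, rfl⟩
    obtain ⟨m, y, rfl⟩ := CW.exists_of p g
    rw [CW.map_of]
    refine ⟨m, _, (W.mem_fil_iff p m 0 _).2 fun i j hj => ?_, rfl⟩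
    rw [W.coeff_map]
    refine ofPowerSeries_coeff_neg _ _ ?_
    rw [Nat.cast_zero, neg_zero] at hj
    by_contra! h
    exact absurd hj (not_lt.2 (mul_nonneg (by positivity) h))

/-- The operator `F` multiplies the degree of co-monomials by `p`. -/
theorem frob_comonomialHom (n m : ℕ) (x : W p m k) :
    CW.frob p _ (comonomialHom p k n m x) =
      comonomialHom p k n (m + 1) (W.shiftFrob p k m (m + 1) m.le_succ x) := by
  refine (CW.frob_of p _ m _).trans ?_
  rw [← CW.of_shift p _ m (m + 1) m.le_succ]
  refine congrArg (CW.of p _ (m + 1)) (TruncatedWittVector.ext fun l => ?_)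
  rw [W.coeff_shift, W.coeff_monomial, W.coeff_shiftFrob]
  split_ifs with hl
  · rw [HahnSeries.single_eq_zero]
  · change (W.monomial p k n m x).coeff _ ^ p = _
    rw [W.coeff_monomial, HahnSeries.single_pow]
    have h2 : m + 1 - m = 1 := Nat.add_sub_cancel_left m 1
    simp only [h2, pow_one]
    refine congrArg (fun j => HahnSeries.single j _) ?_
    have h1 : p ^ (l : ℕ) = p * p ^ ((l : ℕ) - 1) := by
      rw [← pow_succ']
      congr 1
      omega
    rw [h1, nsmul_eq_mul]
    push_cast
    ring

end Leading

/-! ### The operator `F - 1` over `k[[t]]`. -/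

section PowerSeries

variable (p : ℕ) [hp : Fact p.Prime] {k : Type*} [Field k] [CharP k p]

instance PowerSeries.charP (k : Type*) [Field k] [CharP k p] : CharP (PowerSeries k) p :=
  charP_of_injective_algebraMap (algebraMap k (PowerSeries k)).injective p

theorem PowerSeries.exists_pow_sub_eq (a : PowerSeries k) (ha : PowerSeries.constantCoeff a = 0) :
    ∃ b : PowerSeries k, PowerSeries.constantCoeff b = 0 ∧ b ^ p - b = a := by
  -- This is the `t`-adically convergent series `-∑ a ^ p ^ j`. Since `t ^ (j + 1)` divides `a ^ p ^
  -- j`, only the terms with `j ≤ n` contribute in degree `n`.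
  let b : PowerSeries k :=
    PowerSeries.mk fun n => -∑ j ∈ Finset.range (n + 1), PowerSeries.coeff n (a ^ p ^ j)
  have hX : (PowerSeries.X : PowerSeries k) ∣ a := PowerSeries.X_dvd_iff.2 ha
  have hpow : ∀ j, (PowerSeries.X : PowerSeries k) ^ (j + 1) ∣ a ^ p ^ j := fun j =>
    (pow_dvd_pow _ (Nat.lt_pow_self hp.out.one_lt)).trans (pow_dvd_pow_of_dvd hX _)
  have hb : ∀ N, (PowerSeries.X : PowerSeries k) ^ N ∣ b + ∑ j ∈ Finset.range N, a ^ p ^ j := by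
    intro N
    rw [PowerSeries.X_pow_dvd_iff]
    intro n hn
    rw [map_add, PowerSeries.coeff_mk, map_sum, neg_add_eq_zero]
    refine Finset.sum_subset (Finset.range_subset_range.2 hn) fun j _ hj => ?_
    rw [Finset.mem_range] at hj
    exact PowerSeries.X_pow_dvd_iff.1 (hpow j) n (by omega)
  refine ⟨b, ?_, ?_⟩
  · rw [← PowerSeries.coeff_zero_eq_constantCoeff_apply, PowerSeries.coeff_mk]
    simp [ha]
  · rw [← sub_eq_zero]
    ext N
    rw [map_zero]
    have h1 : (PowerSeries.X : PowerSeries k) ^ (N + 1) ∣ b ^ p - b - a := by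
      have h2 := hb (N + 1)
      have h3 : (PowerSeries.X : PowerSeries k) ^ (N + 1) ∣
          (b + ∑ j ∈ Finset.range (N + 1), a ^ p ^ j) ^ p :=
        h2.trans (dvd_pow_self _ hp.out.ne_zero)
      rw [add_pow_char, sum_pow_char] at h3
      -- Frobenius shifts the truncated sum by one index, so the defect telescopes to `a` and a term
      -- divisible by `X ^ (N + 1)`.
      have h4 : ∑ j ∈ Finset.range (N + 1), (a ^ p ^ j) ^ p + a =
          ∑ j ∈ Finset.range (N + 1), a ^ p ^ j + a ^ p ^ (N + 1) := by
        rw [← Finset.sum_range_succ (fun j => a ^ p ^ j), Finset.sum_range_succ' _ (N + 1)]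
        simp only [← pow_mul, ← pow_succ, pow_zero, pow_one]
      have h5 : b ^ p - b - a = (b ^ p + ∑ j ∈ Finset.range (N + 1), (a ^ p ^ j) ^ p) -
          (b + ∑ j ∈ Finset.range (N + 1), a ^ p ^ j) - a ^ p ^ (N + 1) := by
        linear_combination -h4
      rw [h5]
      exact dvd_sub (dvd_sub h3 h2) ((pow_dvd_pow _ (Nat.le_succ _)).trans (hpow (N + 1)))
    exact PowerSeries.X_pow_dvd_iff.1 h1 N N.lt_succ_self

theorem CW.map_C {k : Type*} [Field k] (y : CW p k) :
    CW.map p (HahnSeries.C : k →+* LaurentSeries k) y =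
      CW.map p (HahnSeries.ofPowerSeries ℤ k) (CW.map p PowerSeries.C y) := by
  have h1 : (HahnSeries.C : k →+* LaurentSeries k) =
      (HahnSeries.ofPowerSeries ℤ k).comp PowerSeries.C := by
    ext1 a
    exact (HahnSeries.ofPowerSeries_C a).symm
  rw [h1]
  exact (CW.map_map p _ _ y).symm

theorem CW.map_constantCoeff_map_C {k : Type*} [Field k] (f : CW p k) :
    CW.map p (PowerSeries.constantCoeff (R := k)) (CW.map p PowerSeries.C f) = f := by
  obtain ⟨m, x, rfl⟩ := CW.exists_of p f
  rw [CW.map_of, CW.map_of]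
  refine congrArg (CW.of p k m) (TruncatedWittVector.ext fun i => ?_)
  simp only [W.coeff_map, PowerSeries.constantCoeff_C]

/-- The difference of `g` and its constant term dies under `t ↦ 0`, and `F - 1` is onto that kernel
by `W.exists_frob_sub` and `PowerSeries.exists_pow_sub_eq`. -/
theorem CW.map_constantCoeff_sub_mem_asw (g : CW p (PowerSeries k)) :
    CW.map p (HahnSeries.ofPowerSeries ℤ k) g -
      CW.map p HahnSeries.C (CW.map p (PowerSeries.constantCoeff (R := k)) g) ∈
        CW.asw p (LaurentSeries k) := by
  rw [CW.map_C, ← map_sub]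
  apply CW.map_mem_asw
  obtain ⟨m, x, rfl⟩ := CW.exists_of p g
  obtain ⟨y, hy⟩ := W.exists_frob_sub p (PowerSeries.constantCoeff (R := k))
    (PowerSeries.exists_pow_sub_eq p) m (x - W.map p m PowerSeries.C
      (W.map p m (PowerSeries.constantCoeff (R := k)) x)) (by
    rw [map_sub, sub_eq_zero]
    refine TruncatedWittVector.ext fun i => ?_
    simp only [W.coeff_map, PowerSeries.constantCoeff_C])
  refine (CW.mem_asw p _).2 ⟨CW.of p _ m y, ?_⟩
  rw [CW.frob_of, ← map_sub, hy, map_sub, CW.map_of, CW.map_of]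

end PowerSeries

/-! ### The decomposition of `CW(k((t)))` in co-monomials -/

section Decomposition

variable (p : ℕ) [hp : Fact p.Prime] (k : Type*) [Field k]

theorem exists_eq_mul_pow (d : ℕ) (hd : 0 < d) :
    ∃ (n : Jp p) (m : ℕ), d = n * p ^ m := by
  obtain ⟨m, n, hn, rfl⟩ := Nat.exists_eq_pow_mul_and_not_dvd hd.ne' p hp.out.ne_one
  refine ⟨⟨n, Nat.pos_of_mul_pos_left hd, ?_⟩, m, mul_comm _ _⟩
  exact ((Nat.Prime.coprime_iff_not_dvd hp.out).2 hn).symm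

theorem eq_of_mul_pow_eq {n n' m m' : ℕ} (hn : n.Coprime p) (hn' : n'.Coprime p)
    (h : n * p ^ m = n' * p ^ m') : m = m' := by
  have key : ∀ {n n' m m' : ℕ}, n'.Coprime p → n * p ^ m = n' * p ^ m' → m ≤ m' := by
    intro n n' m m' hn' h
    exact (Nat.pow_dvd_pow_iff_le_right hp.out.one_lt).1
      ((hn'.symm.pow_left m).dvd_of_dvd_mul_left (h ▸ dvd_mul_left _ _))
  exact le_antisymm (key hn' h) (key hn h.symm)

/-- The group of families of coefficients of co-monomials, and of integral covectors. -/
abbrev Coeffs : Type _ := (⨁ q : Jp p × ℕ, W p q.2 k) × CW p (PowerSeries k)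

/-- The sum of co-monomials and of an integral covector. -/
def coeffsSum : Coeffs p k →+ CW p (LaurentSeries k) :=
  (DirectSum.toAddMonoid fun q : Jp p × ℕ => comonomialHom p k q.1 q.2).coprod
    (CW.map p (HahnSeries.ofPowerSeries ℤ k))

theorem coeffsSum_of (q : Jp p × ℕ) (x : W p q.2 k) :
    coeffsSum p k (DirectSum.of (fun q : Jp p × ℕ => W p q.2 k) q x, 0) =
      comonomialHom p k q.1 q.2 x := by
  rw [coeffsSum, AddMonoidHom.coprod_apply, DirectSum.toAddMonoid_of, map_zero, add_zero]

theorem coeffsSum_zero_left (g : CW p (PowerSeries k)) :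
    coeffsSum p k (0, g) = CW.map p (HahnSeries.ofPowerSeries ℤ k) g := by
  rw [coeffsSum, AddMonoidHom.coprod_apply, map_zero, zero_add]

variable [CharP k p]

/-- In a nontrivial relation take the co-monomial of largest degree `n pᵐ`. All other terms lie in
an earlier step of the filtration, so it does too, contradicting `comonomialHom_eq_zero_of_mem`. -/
theorem coeffsSum_injective : Function.Injective (coeffsSum p k) := by
  classical
  rw [injective_iff_map_eq_zero]
  rintro ⟨z, g⟩ h
  have hz : z = 0 := by
    by_contra hz
    obtain ⟨q, hq, hmax⟩ := z.support.exists_max_image (fun q => (q.1 : ℕ) * p ^ q.2)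
      (Finset.nonempty_iff_ne_empty.2 fun h => hz (DFinsupp.support_eq_empty.1 h))
    have hq0 : 0 < (q.1 : ℕ) * p ^ q.2 := Nat.mul_pos q.1.2.1 (pow_pos hp.out.pos _)
    refine DFinsupp.mem_support_iff.1 hq (comonomialHom_eq_zero_of_mem p
      (Nat.sub_one_lt hq0.ne') (z q) ?_)
    rw [coeffsSum, AddMonoidHom.coprod_apply, ← DirectSum.sum_support_of z, map_sum] at h
    simp only [DirectSum.toAddMonoid_of] at h
    rw [← Finset.add_sum_erase _ _ hq, add_assoc, add_eq_zero_iff_eq_neg] at h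
    rw [h]
    refine neg_mem (add_mem (sum_mem fun r hr => ?_) (CW.fil_mono p (Nat.zero_le _)
      ((CW.mem_fil_zero_iff p _).2 ⟨g, rfl⟩)))
    obtain ⟨hrq, hr⟩ := Finset.mem_erase.1 hr
    -- Distinct pairs `(n, m)` have distinct degrees because `n` is prime to `p`, so the maximum is
    -- strict.
    refine CW.fil_mono p (Nat.le_sub_one_of_lt (lt_of_le_of_ne (hmax r hr) fun he => hrq ?_))
      (comonomialHom_mem_fil p r.1 r.2 (z r))
    have h2 := eq_of_mul_pow_eq p r.1.2.2 q.1.2.2 he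
    rw [h2] at he
    exact Prod.ext (Subtype.ext (Nat.eq_of_mul_eq_mul_right (pow_pos hp.out.pos _) he)) h2
  subst hz
  rw [coeffsSum_zero_left] at h
  rw [CW.map_injective p HahnSeries.ofPowerSeries_injective (h.trans (map_zero _).symm)]
  rfl

variable {k} in
/-- Induction along the filtration `Fil_d(CW(k((t))))`. -/
theorem CW.fil_induction {P : ℕ → CW p (LaurentSeries k) → Prop}
    (zero : ∀ g, P 0 (CW.map p (HahnSeries.ofPowerSeries ℤ k) g))
    (succ : ∀ (d : ℕ) (n : Jp p) (m : ℕ) (x : W p m k) f, d + 1 = n * p ^ m → P d f →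
      P (d + 1) (comonomialHom p k n m x + f))
    (d : ℕ) (f : CW p (LaurentSeries k)) (hf : f ∈ CW.fil p k d) : P d f := by
  induction d generalizing f with
  | zero =>
    obtain ⟨g, rfl⟩ := (CW.mem_fil_zero_iff p f).1 hf
    exact zero g
  | succ d ih =>
    obtain ⟨n, m, hd⟩ := exists_eq_mul_pow p (d + 1) d.succ_pos
    obtain ⟨x, hx⟩ := exists_sub_comonomialHom_mem p n.2.2 hd f hf
    rw [← add_sub_cancel (comonomialHom p k n m x) f]
    exact succ d n m x _ hd (ih _ hx)

theorem coeffsSum_surjective : Function.Surjective (coeffsSum p k) := by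
  intro f
  obtain ⟨d, hd⟩ := CW.exists_mem_fil p f
  refine CW.fil_induction p (P := fun _ f => ∃ w, coeffsSum p k w = f)
    (fun g => ⟨(0, g), coeffsSum_zero_left p k g⟩) ?_ d f hd
  rintro d n m x _ - ⟨w, rfl⟩
  exact ⟨_ + w, by rw [map_add, coeffsSum_of p k (n, m) x]⟩

/-- The unique decomposition of covectors as sums of co-monomials and of an integral covector. -/
def coeffsEquiv : Coeffs p k ≃+ CW p (LaurentSeries k) :=
  AddEquiv.ofBijective (coeffsSum p k) ⟨coeffsSum_injective p k, coeffsSum_surjective p k⟩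

/-- The group `(⨁_{n ∈ J_p} CW~(k)) ⊕ CW(k) / (F - 1) CW(k)`. -/
abbrev Residues : Type _ := (⨁ _ : Jp p, CWt p k) × (CW p k ⧸ CW.asw p k)

/-- The map of coefficients that corresponds to the projection
`CW(k((t))) → CW(k((t))) / (F - 1)`. -/
def coeffsResidue : Coeffs p k →+ Residues p k :=
  AddMonoidHom.prodMap
    (DirectSum.toAddMonoid fun q : Jp p × ℕ =>
      (DirectSum.of (fun _ : Jp p => CWt p k) q.1).comp (CWt.of p k q.2))
    ((QuotientAddGroup.mk' (CW.asw p k)).comp (CW.map p (PowerSeries.constantCoeff (R := k))))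

theorem coeffsResidue_of (q : Jp p × ℕ) (x : W p q.2 k) :
    coeffsResidue p k (DirectSum.of (fun q : Jp p × ℕ => W p q.2 k) q x, 0) =
      (DirectSum.of (fun _ : Jp p => CWt p k) q.1 (CWt.of p k q.2 x), 0) := by
  refine Prod.ext ?_ (map_zero ((QuotientAddGroup.mk' (CW.asw p k)).comp
    (CW.map p (PowerSeries.constantCoeff (R := k)))))
  exact DirectSum.toAddMonoid_of _ _ _

theorem coeffsResidue_zero_left (g : CW p (PowerSeries k)) : coeffsResidue p k (0, g) =
    (0, QuotientAddGroup.mk (CW.map p (PowerSeries.constantCoeff (R := k)) g)) :=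
  Prod.ext (map_zero (DirectSum.toAddMonoid fun q : Jp p × ℕ =>
    (DirectSum.of (fun _ : Jp p => CWt p k) q.1).comp (CWt.of p k q.2))) rfl

/-- The residue of a covector over `k((t))`. -/
def residue : CW p (LaurentSeries k) →+ Residues p k :=
  (coeffsResidue p k).comp (coeffsEquiv p k).symm.toAddMonoidHom

theorem residue_coeffsSum (w : Coeffs p k) :
    residue p k (coeffsSum p k w) = coeffsResidue p k w :=
  congrArg (coeffsResidue p k) ((coeffsEquiv p k).symm_apply_apply w)

variable {k} in
theorem residue_comonomialHom (n : Jp p) (m : ℕ) (x : W p m k) :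
    residue p k (comonomialHom p k n m x) =
      (DirectSum.of (fun _ : Jp p => CWt p k) n (CWt.of p k m x), 0) := by
  rw [← coeffsResidue_of p k (n, m), ← residue_coeffsSum, coeffsSum_of]

variable {k} in
theorem residue_map_ofPowerSeries (g : CW p (PowerSeries k)) :
    residue p k (CW.map p (HahnSeries.ofPowerSeries ℤ k) g) =
      (0, QuotientAddGroup.mk (CW.map p (PowerSeries.constantCoeff (R := k)) g)) := by
  rw [← coeffsResidue_zero_left, ← residue_coeffsSum, coeffsSum_zero_left]

variable {k} in
/-- Homomorphisms on `CW(k((t)))` are equal if they agree on co-monomials and on `CW(k[[t]])`. -/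
theorem CW.hom_ext {A : Type*} [AddCommGroup A] {φ ψ : CW p (LaurentSeries k) →+ A}
    (h : ∀ (n : Jp p) (m : ℕ) (x : W p m k),
      φ (comonomialHom p k n m x) = ψ (comonomialHom p k n m x))
    (h' : ∀ g, φ (CW.map p (HahnSeries.ofPowerSeries ℤ k) g) =
      ψ (CW.map p (HahnSeries.ofPowerSeries ℤ k) g)) : φ = ψ := by
  refine DFunLike.ext _ _ fun f => ?_
  obtain ⟨d, hd⟩ := CW.exists_mem_fil p f
  refine CW.fil_induction p (P := fun _ f => φ f = ψ f) h' ?_ d f hd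
  intro d n m x f _ hf
  rw [map_add, map_add, h, hf]

/-- The residue is unchanged by `F`. On co-monomials, `F` acts by the transition map `VF` of
`CW~(k)`; on `CW(k[[t]])`, the constant term changes by an element of `(F - 1) CW(k)`. -/
theorem asw_le_ker_residue : CW.asw p (LaurentSeries k) ≤ (residue p k).ker := by
  have key : (residue p k).comp (CW.frob p _) = residue p k := by
    refine CW.hom_ext p (A := Residues p k) (fun n m x => ?_) fun g => ?_
    · rw [AddMonoidHom.comp_apply, frob_comonomialHom, residue_comonomialHom,
        residue_comonomialHom, CWt.of_shiftFrob]
    · rw [AddMonoidHom.comp_apply, ← CW.map_frob, residue_map_ofPowerSeries,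
        residue_map_ofPowerSeries, CW.map_frob]
      refine Prod.ext rfl (QuotientAddGroup.eq.2 ?_)
      rw [← neg_mem_iff, neg_add, neg_neg, ← sub_eq_add_neg]
      exact (CW.mem_asw p _).2 ⟨_, rfl⟩
  intro f hf
  obtain ⟨y, rfl⟩ := (CW.mem_asw p f).1 hf
  rw [AddMonoidHom.mem_ker, map_sub]
  exact sub_eq_zero.2 (DFunLike.congr_fun key y)

/-- The map induced by the residue on `CW(k((t))) / (F - 1)`. -/
def residueQuot : (CW p (LaurentSeries k) ⧸ CW.asw p (LaurentSeries k)) →+ Residues p k :=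
  QuotientAddGroup.lift _ (residue p k) (asw_le_ker_residue p k)

theorem residueQuot_mk (f : CW p (LaurentSeries k)) :
    residueQuot p k (QuotientAddGroup.mk f) = residue p k f := rfl

/-- The map `CW~(k) → CW(k((t))) / (F - 1)` defined by the co-monomials `λ t^{-npᵐ}`. -/
def comonomialQuot (n : ℕ) : CWt p k →+ (CW p (LaurentSeries k) ⧸ CW.asw p (LaurentSeries k)) :=
  AddCommGroup.DirectLimit.lift (fun m : ℕ => W p m k) (W.shiftFrob p k) _
    (fun m => (QuotientAddGroup.mk' _).comp (comonomialHom p k n m)) (by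
      -- One step of compatibility with the direct system is the congruence of a co-monomial with
      -- its image under `F`.
      have h1 : ∀ (m : ℕ) (x : W p m k), (QuotientAddGroup.mk' (CW.asw p (LaurentSeries k)))
          (comonomialHom p k n (m + 1) (W.shiftFrob p k m (m + 1) m.le_succ x)) =
            QuotientAddGroup.mk' _ (comonomialHom p k n m x) := by
        intro m x
        rw [← frob_comonomialHom, ← sub_eq_zero, ← map_sub]
        exact (QuotientAddGroup.eq_zero_iff _).2 ((CW.mem_asw p _).2 ⟨_, rfl⟩)
      intro i j hij x
      simp only [AddMonoidHom.comp_apply]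
      induction j, hij using Nat.le_induction with
      | base => rw [DirectedSystem.map_self (f := fun i j h => W.shiftFrob p k i j h)]
      | succ j hij ih =>
        rw [← DirectedSystem.map_map (f := fun i j h => W.shiftFrob p k i j h) hij j.le_succ,
          h1, ih])

theorem comonomialQuot_of (n m : ℕ) (x : W p m k) : comonomialQuot p k n (CWt.of p k m x) =
    QuotientAddGroup.mk (comonomialHom p k n m x) :=
  AddCommGroup.DirectLimit.lift_of (G := fun m : ℕ => W p m k) _ _ _ m x

/-- The inverse of the residue. -/
def residueInv : Residues p k →+ (CW p (LaurentSeries k) ⧸ CW.asw p (LaurentSeries k)) :=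
  (DirectSum.toAddMonoid fun n : Jp p => comonomialQuot p k n).coprod
    (QuotientAddGroup.map _ _ (CW.map p HahnSeries.C) fun _ hx => CW.map_mem_asw p _ hx)

theorem residueInv_of (n : Jp p) (m : ℕ) (x : W p m k) :
    residueInv p k (DirectSum.of (fun _ : Jp p => CWt p k) n (CWt.of p k m x), 0) =
      QuotientAddGroup.mk (comonomialHom p k n m x) := by
  rw [residueInv, AddMonoidHom.coprod_apply, DirectSum.toAddMonoid_of, map_zero, add_zero,
    comonomialQuot_of]

theorem residueInv_mk (f : CW p k) : residueInv p k (0, QuotientAddGroup.mk f) =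
    QuotientAddGroup.mk (CW.map p HahnSeries.C f) := by
  rw [residueInv, AddMonoidHom.coprod_apply, map_zero, zero_add]
  rfl

/-- It suffices to check co-monomials and `CW(k[[t]])`. On the latter the point is that a covector
and its constant term agree modulo `F - 1`. -/
theorem residueInv_residue (f : CW p (LaurentSeries k)) :
    residueInv p k (residue p k f) = QuotientAddGroup.mk f := by
  have key : (residueInv p k).comp (residue p k) = QuotientAddGroup.mk' _ := by
    refine CW.hom_ext p (fun n m x => ?_) fun g => ?_
    · rw [AddMonoidHom.comp_apply, residue_comonomialHom, residueInv_of]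
      rfl
    · rw [AddMonoidHom.comp_apply, residue_map_ofPowerSeries, residueInv_mk]
      refine QuotientAddGroup.eq.2 ?_
      rw [neg_add_eq_sub]
      exact CW.map_constantCoeff_sub_mem_asw p g
  exact DFunLike.congr_fun key f

theorem residue_map_C (f : CW p k) : residue p k (CW.map p HahnSeries.C f) =
    (0, QuotientAddGroup.mk f) := by
  rw [CW.map_C, residue_map_ofPowerSeries, CW.map_constantCoeff_map_C]

theorem residueQuot_residueInv (z : Residues p k) : residueQuot p k (residueInv p k z) = z := by
  have h1 : ∀ z, residueQuot p k (residueInv p k (z, 0)) = (z, 0) := by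
    intro z
    induction z using DirectSum.induction_on with
    | zero => exact ((residueQuot p k).comp (residueInv p k)).map_zero
    | of n x =>
      obtain ⟨m, x, rfl⟩ := CWt.exists_of p x
      rw [residueInv_of, residueQuot_mk, residue_comonomialHom]
    | add x y hx hy =>
      have h2 : ((x + y, 0) : Residues p k) = (x, 0) + (y, 0) := by simp
      rw [h2, map_add, map_add, hx, hy]
  obtain ⟨z, c⟩ := z
  obtain ⟨c, rfl⟩ := QuotientAddGroup.mk_surjective c
  have h2 : ((z, QuotientAddGroup.mk c) : Residues p k) = (z, 0) + (0, QuotientAddGroup.mk c) := by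
    simp
  rw [h2, map_add, map_add, h1, residueInv_mk, residueQuot_mk, residue_map_C]

/-- The isomorphism
`(⨁_{n ∈ J_p} CW~(k)) ⊕ CW(k) / (F - 1) CW(k) ≃ CW(k((t))) / (F - 1) CW(k((t)))`. -/
def residueEquiv : Residues p k ≃+ (CW p (LaurentSeries k) ⧸ CW.asw p (LaurentSeries k)) :=
  { residueInv p k with
    invFun := residueQuot p k
    left_inv := residueQuot_residueInv p k
    right_inv := fun f => by
      obtain ⟨f, rfl⟩ := QuotientAddGroup.mk_surjective f
      exact residueInv_residue p k f }

theorem residueEquiv_apply (z : Residues p k) : residueEquiv p k z = residueInv p k z := rfl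

theorem residueEquiv_eq_mk_iff (z : Residues p k) (f : CW p (LaurentSeries k)) :
    residueEquiv p k z = QuotientAddGroup.mk f ↔ z = residue p k f := by
  rw [← AddEquiv.eq_symm_apply]
  rfl

/-! ### The filtration on the residues -/

/-- The filtration of the residues that corresponds to Kato's filtration. -/
def Residues.fil (d : ℕ) : AddSubgroup (Residues p k) where
  -- For `n > d` the set of exponents is empty and its `sSup` is `0`, so vanishing must be imposed
  -- separately. For `d = 0` this leaves only the last summand.
  carrier := {z | ∀ n : Jp p,
    ((n : ℕ) ≤ d → z.1 n ∈ CWt.fil p k (sSup {m : ℕ | n * p ^ m ≤ d})) ∧ (d < (n : ℕ) → z.1 n = 0)}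
  zero_mem' := fun n => ⟨fun _ => zero_mem _, fun _ => rfl⟩
  add_mem' := fun {a b} ha hb n => ⟨fun h => by
    rw [Prod.fst_add, DirectSum.add_apply]
    exact add_mem ((ha n).1 h) ((hb n).1 h), fun h => by
    rw [Prod.fst_add, DirectSum.add_apply, (ha n).2 h, (hb n).2 h, add_zero]⟩
  neg_mem' := fun {a} ha n => ⟨fun h => by
    rw [Prod.fst_neg]
    exact neg_mem ((ha n).1 h), fun h => by
    rw [Prod.fst_neg]
    exact neg_eq_zero.2 ((ha n).2 h)⟩

theorem bddAbove_mul_pow_le {n d : ℕ} (hn : 0 < n) : BddAbove {m : ℕ | n * p ^ m ≤ d} :=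
  ⟨d, fun _ hm => ((Nat.lt_pow_self hp.out.one_lt).le.trans (Nat.le_mul_of_pos_left _ hn)).trans hm⟩

theorem mul_pow_sSup_le {n d : ℕ} (hn : 0 < n) (hd : n ≤ d) :
    n * p ^ sSup {m : ℕ | n * p ^ m ≤ d} ≤ d :=
  Nat.sSup_mem (s := {m : ℕ | n * p ^ m ≤ d}) ⟨0, show _ * p ^ 0 ≤ d by simpa using hd⟩
    (bddAbove_mul_pow_le p hn)

theorem Residues.fil_mono {d e : ℕ} (h : d ≤ e) : Residues.fil p k d ≤ Residues.fil p k e := by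
  intro z hz n
  refine ⟨fun hn => ?_, fun hn => (hz n).2 (h.trans_lt hn)⟩
  rcases le_or_gt (n : ℕ) d with hnd | hnd
  · exact CWt.fil_mono p k (csSup_le_csSup (bddAbove_mul_pow_le p n.2.1)
      ⟨0, show _ * p ^ 0 ≤ d by simpa using hnd⟩
      fun m hm => le_trans hm h) ((hz n).1 hnd)
  · rw [(hz n).2 hnd]
    exact zero_mem _

theorem Residues.of_mem_fil {d m : ℕ} (n : Jp p) (hd : (n : ℕ) * p ^ m ≤ d) (x : W p m k) :
    (DirectSum.of (fun _ : Jp p => CWt p k) n (CWt.of p k m x), 0) ∈ Residues.fil p k d := by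
  intro n'
  have h0 : (n : ℕ) ≤ d := (Nat.le_mul_of_pos_right _ (pow_pos hp.out.pos m)).trans hd
  by_cases h : n' = n
  · subst h
    refine ⟨fun _ => ?_, fun h => absurd h0 (not_le.2 h)⟩
    rw [DirectSum.of_eq_same]
    exact CWt.fil_mono p k (le_csSup (bddAbove_mul_pow_le p n'.2.1) hd) ⟨x, rfl⟩
  · rw [DirectSum.of_eq_of_ne _ _ _ h]
    exact ⟨fun _ => zero_mem _, fun _ => rfl⟩

theorem residue_mem_fil {d : ℕ} (f : CW p (LaurentSeries k)) (hf : f ∈ CW.fil p k d) :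
    residue p k f ∈ Residues.fil p k d := by
  refine CW.fil_induction p (P := fun d f => residue p k f ∈ Residues.fil p k d)
    (fun g => ?_) (fun d n m x f hd hf => ?_) d f hf
  · rw [residue_map_ofPowerSeries]
    exact fun n => ⟨fun _ => zero_mem _, fun _ => rfl⟩
  · rw [map_add, residue_comonomialHom]
    exact add_mem (Residues.of_mem_fil p k n hd.ge x) (Residues.fil_mono p k d.le_succ hf)

/-- The component at `n` is lifted by a co-monomial of degree at most `d`, thanks to the bound on
its level in `CW~(k)`; the unramified component is lifted by constants, in `Fil_0`. -/
theorem residueInv_mem_of_mem_fil {d : ℕ} (z : Residues p k) (hz : z ∈ Residues.fil p k d) :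
    residueInv p k z ∈ (CW.fil p k d).map (QuotientAddGroup.mk' _) := by
  classical
  obtain ⟨z, c⟩ := z
  have h1 : ((z, c) : Residues p k) = (z, 0) + (0, c) := by simp
  rw [h1, map_add]
  refine add_mem ?_ ?_
  · rw [residueInv, AddMonoidHom.coprod_apply, map_zero, add_zero, ← DirectSum.sum_support_of z,
      map_sum]
    refine sum_mem fun n hn => ?_
    rw [DirectSum.toAddMonoid_of]
    have hnd : (n : ℕ) ≤ d := by
      by_contra! h
      exact DFinsupp.mem_support_iff.1 hn ((hz n).2 h)
    obtain ⟨x, hx⟩ := (hz n).1 hnd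
    simp only at hx
    rw [← hx, comonomialQuot_of]
    exact ⟨_, CW.fil_mono p (mul_pow_sSup_le p n.2.1 hnd) (comonomialHom_mem_fil p _ _ x), rfl⟩
  · obtain ⟨c, rfl⟩ := QuotientAddGroup.mk_surjective c
    rw [residueInv_mk]
    refine ⟨_, CW.fil_mono p d.zero_le ?_, rfl⟩
    exact (CW.mem_fil_zero_iff p _).2 ⟨_, (CW.map_C p c).symm⟩

theorem H1.mem_fil_iff (d : ℕ) (χ : H1 (Gsep (LaurentSeries k)) (QpZp p)) :
    χ ∈ H1.fil p k d ↔ ∃ f ∈ CW.fil p k d, aswHom p (LaurentSeries k) f = χ := by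
  constructor
  · rintro ⟨⟨f, χ⟩, ⟨h1, h2, -⟩, rfl⟩
    exact ⟨f, h2, (mem_aswGraph_iff p f χ).1 h1⟩
  · rintro ⟨f, hf, rfl⟩
    exact ⟨(f, _), ⟨(mem_aswGraph_iff p f _).2 rfl, hf, trivial⟩, rfl⟩

theorem aswEquiv_residueEquiv_mem_fil_iff (d : ℕ) (z : Residues p k) :
    aswEquiv p _ (residueEquiv p k z) ∈ H1.fil p k d ↔ z ∈ Residues.fil p k d := by
  rw [H1.mem_fil_iff]
  constructor
  · rintro ⟨f, hf, h⟩
    rw [← aswEquiv_mk, (aswEquiv p _).injective.eq_iff, eq_comm, residueEquiv_eq_mk_iff] at h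
    rw [h]
    exact residue_mem_fil p k f hf
  · intro h
    obtain ⟨f, hf, h⟩ := residueInv_mem_of_mem_fil p k z h
    exact ⟨f, hf, by rw [← aswEquiv_mk, residueEquiv_apply, ← h]; rfl⟩

end Decomposition

/-! ### Graded pieces -/

section Graded

variable {M : Type*} [AddCommGroup M] (F : ℕ → AddSubgroup M)

theorem Gr.mk_surjective (d : ℕ) : Function.Surjective (Gr.mk F d) :=
  QuotientAddGroup.mk_surjective

theorem Gr.mk_eq_zero_iff (d : ℕ) (x : F d) : Gr.mk F d x = 0 ↔ (x : M) ∈ prevFil F d :=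
  (QuotientAddGroup.eq_zero_iff x).trans AddSubgroup.mem_addSubgroupOf

/-- The graded piece of degree zero. -/
def Gr.zeroEquiv : Gr F 0 ≃+ F 0 :=
  (AddEquiv.ofBijective (Gr.mk F 0) ⟨(injective_iff_map_eq_zero _).2 fun x hx =>
    Subtype.ext ((Gr.mk_eq_zero_iff F 0 x).1 hx), Gr.mk_surjective F 0⟩).symm

theorem Gr.zeroEquiv_mk (x : F 0) : Gr.zeroEquiv F (Gr.mk F 0 x) = x :=
  (Gr.zeroEquiv F).apply_symm_apply x

/-- The isomorphism `A / N ≃ B` defined by an epimorphism `A → B` with kernel `N`. -/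
def quotientEquivOfKer {A B : Type*} [AddCommGroup A] [AddGroup B] (φ : A →+ B)
    (hφ : Function.Surjective φ) (N : AddSubgroup A) (hN : ∀ x, φ x = 0 ↔ x ∈ N) : A ⧸ N ≃+ B :=
  (QuotientAddGroup.quotientAddEquivOfEq (show N = φ.ker from AddSubgroup.ext fun x =>
    (hN x).symm)).trans (QuotientAddGroup.quotientKerEquivOfSurjective φ hφ)

end Graded

/-! ### The Artin–Schreier–Witt morphism on graded pieces. -/

section KatoGraded

variable (p : ℕ) [hp : Fact p.Prime] (k : Type*) [Field k] [CharP k p]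

/-- The Artin-Schreier-Witt morphism on the steps of Kato's filtrations. -/
def aswFil (d : ℕ) : CW.fil p k d →+ H1.fil p k d :=
  ((aswHom p (LaurentSeries k)).comp (CW.fil p k d).subtype).codRestrict _
    fun f => (H1.mem_fil_iff p k d _).2 ⟨f, f.2, rfl⟩

theorem aswFil_surjective (d : ℕ) : Function.Surjective (aswFil p k d) := by
  rintro ⟨χ, hχ⟩
  obtain ⟨f, hf, rfl⟩ := (H1.mem_fil_iff p k d _).1 hχ
  exact ⟨⟨f, hf⟩, rfl⟩

/-- The epimorphism `Gr_d(CW(k((t)))) → Gr_d(H¹)`. -/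
def grProj (d : ℕ) : Gr (CW.fil p k) d →+ Gr (H1.fil p k) d :=
  QuotientAddGroup.map _ _ (aswFil p k d) (by
    rintro ⟨f, hf⟩ h
    rw [AddSubgroup.mem_addSubgroupOf] at h
    rw [AddSubgroup.mem_comap, AddSubgroup.mem_addSubgroupOf]
    -- The previous step is `⊥` for `d = 0` and an actual step of the filtration otherwise.
    rcases d with _ | d
    · obtain rfl : f = 0 := h
      exact map_zero (aswHom p (LaurentSeries k))
    · exact (H1.mem_fil_iff p k d _).2 ⟨f, h, rfl⟩)

theorem grProj_mk (d : ℕ) (f : CW.fil p k d) :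
    grProj p k d (Gr.mk _ d f) = Gr.mk _ d (aswFil p k d f) := rfl

theorem grProj_surjective (d : ℕ) : Function.Surjective (grProj p k d) := by
  intro χ
  obtain ⟨χ, rfl⟩ := Gr.mk_surjective _ d χ
  obtain ⟨f, rfl⟩ := aswFil_surjective p k d χ
  exact ⟨_, grProj_mk p k d f⟩

variable {k} in
theorem aswHom_mem_fil_iff (d : ℕ) (f : CW p (LaurentSeries k)) :
    aswHom p _ f ∈ H1.fil p k d ↔ residue p k f ∈ Residues.fil p k d := by
  rw [← aswEquiv_residueEquiv_mem_fil_iff, residueEquiv_apply, residueInv_residue]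
  rfl

variable {k} in
-- The transition map `VF` is multiplication by `p`, so the image of `W_m(k)` in `W_{m+1}(k)` is `p
-- W_{m+1}(k)`; injectivity into the limit lets the comparison be made there.
theorem CWt.of_mem_fil_iff (m : ℕ) (x : W p (m + 1) k) :
    CWt.of p k (m + 1) x ∈ CWt.fil p k m ↔ ∃ y, p • y = x := by
  constructor
  · rintro ⟨y, hy⟩
    rw [← CWt.of_shiftFrob p k m (m + 1) m.le_succ] at hy
    obtain ⟨y, rfl⟩ := WittVector.truncate_surjective p (m + 1) k y
    exact ⟨_, (W.nsmul_truncate p k m y).trans (CWt.of_injective p k (m + 1) hy)⟩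
  · rintro ⟨y, rfl⟩
    obtain ⟨y, rfl⟩ := WittVector.truncate_surjective p (m + 1 + 1) k y
    rw [W.nsmul_truncate, CWt.of_shiftFrob]
    exact ⟨_, rfl⟩

variable {k} in
-- Just below degree `n pᵐ`, the level allowed at `n` is `m - 1` if `m > 0`, which means
-- divisibility by `p`. If `m = 0`, then `n > d` forces the component to vanish, in accordance with
-- `p W_0(k) = 0`.
theorem aswHom_comonomialHom_mem_fil_iff {n m d : ℕ} (hn : n.Coprime p) (hd : d + 1 = n * p ^ m)
    (x : W p m k) : aswHom p _ (comonomialHom p k n m x) ∈ H1.fil p k d ↔ ∃ y, p • y = x := by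
  have hn0 : 1 ≤ n := Nat.pos_of_mul_pos_right (show 0 < n * p ^ m by omega)
  obtain ⟨n, rfl⟩ : ∃ n' : Jp p, (n' : ℕ) = n := ⟨⟨n, hn0, hn⟩, rfl⟩
  rw [aswHom_mem_fil_iff, residue_comonomialHom]
  rcases m with _ | m
  · rw [pow_zero, mul_one] at hd
    constructor
    · intro h
      have h1 := (h n).2 (by omega)
      rw [DirectSum.of_eq_same, ← map_zero (CWt.of p k 0)] at h1
      exact ⟨0, by rw [CWt.of_injective p k 0 h1, smul_zero]⟩
    · rintro ⟨y, rfl⟩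
      rw [W.nsmul_zero, map_zero, map_zero]
      exact zero_mem _
  · have h1 : p ^ m * p ≤ p ^ (m + 1) := (pow_succ p m).ge
    have h2 : (n : ℕ) * p ^ m ≤ d := by
      have h3 : (n : ℕ) * p ^ m < n * p ^ (m + 1) :=
        Nat.mul_lt_mul_of_pos_left (Nat.pow_lt_pow_right hp.out.one_lt m.lt_succ_self) hn0
      omega
    have h3 : (n : ℕ) ≤ d := (Nat.le_mul_of_pos_right _ (pow_pos hp.out.pos m)).trans h2
    rw [← CWt.of_mem_fil_iff]
    constructor
    · intro h
      have h4 := (h n).1 h3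
      rw [DirectSum.of_eq_same] at h4
      refine CWt.fil_mono p k ?_ h4
      have h5 := mul_pow_sSup_le p n.2.1 h3
      -- A level above `m` would give `n p^{m+1} ≤ d`, whereas `n p^{m+1} = d + 1`.
      by_contra! h6
      have h7 : (n : ℕ) * p ^ (m + 1) ≤ n * p ^ sSup {m : ℕ | (n : ℕ) * p ^ m ≤ d} :=
        Nat.mul_le_mul_left _ (Nat.pow_le_pow_right hp.out.pos h6)
      omega
    · rintro ⟨y, hy⟩
      rw [← hy]
      exact Residues.of_mem_fil p k n h2 y

/-- The isomorphism `W_m(k) ≃ Gr_d(CW(k((t))))`, for `d = npᵐ` with `n` prime to `p`. -/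
def grComonomial {n m d : ℕ} (hn : n.Coprime p) (hd : d + 1 = n * p ^ m) :
    W p m k ≃+ Gr (CW.fil p k) (d + 1) :=
  AddEquiv.ofBijective ((Gr.mk (CW.fil p k) (d + 1)).comp ((comonomialHom p k n m).codRestrict _
    fun x => hd ▸ comonomialHom_mem_fil p n m x)) <| by
    constructor
    · rw [injective_iff_map_eq_zero]
      intro x hx
      exact comonomialHom_eq_zero_of_mem p (by omega) x ((Gr.mk_eq_zero_iff _ _ _).1 hx)
    · intro f
      obtain ⟨f, rfl⟩ := Gr.mk_surjective _ _ f
      obtain ⟨x, hx⟩ := exists_sub_comonomialHom_mem p hn hd f.1 f.2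
      refine ⟨x, ?_⟩
      rw [eq_comm, ← sub_eq_zero, AddMonoidHom.comp_apply, ← map_sub, Gr.mk_eq_zero_iff]
      exact hx

theorem grComonomial_apply {n m d : ℕ} (hn : n.Coprime p) (hd : d + 1 = n * p ^ m) (x : W p m k) :
    grComonomial p k hn hd x = Gr.mk (CW.fil p k) (d + 1)
      ⟨comonomialHom p k n m x, hd ▸ comonomialHom_mem_fil p n m x⟩ := rfl

theorem grProj_grComonomial_eq_zero_iff {n m d : ℕ} (hn : n.Coprime p) (hd : d + 1 = n * p ^ m)
    (x : W p m k) : grProj p k (d + 1) (grComonomial p k hn hd x) = 0 ↔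
      x ∈ (nsmulAddMonoidHom (α := W p m k) p).range := by
  rw [grComonomial_apply, grProj_mk, Gr.mk_eq_zero_iff]
  exact aswHom_comonomialHom_mem_fil_iff p hn hd x

/-- The isomorphism `W_m(k) / p W_m(k) ≃ Gr_d(H¹)`, for `d = npᵐ` with `n` prime to `p`. -/
def grWittQuot {n m d : ℕ} (hn : n.Coprime p) (hd : d + 1 = n * p ^ m) :
    (W p m k ⧸ (nsmulAddMonoidHom (α := W p m k) p).range) ≃+ Gr (H1.fil p k) (d + 1) :=
  quotientEquivOfKer ((grProj p k (d + 1)).comp (grComonomial p k hn hd).toAddMonoidHom)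
    ((grProj_surjective p k _).comp (grComonomial p k hn hd).surjective) _
    (grProj_grComonomial_eq_zero_iff p k hn hd)

/-- The isomorphism `CW(k[[t]]) ≃ Gr_0(CW(k((t))))`. -/
def grIntegral : CW p (PowerSeries k) ≃+ Gr (CW.fil p k) 0 :=
  AddEquiv.ofBijective ((Gr.mk (CW.fil p k) 0).comp
    ((CW.map p (HahnSeries.ofPowerSeries ℤ k)).codRestrict _
      fun g => (CW.mem_fil_zero_iff p _).2 ⟨g, rfl⟩)) <| by
    constructor
    · rw [injective_iff_map_eq_zero]
      intro g hg
      have h : CW.map p (HahnSeries.ofPowerSeries ℤ k) g = 0 := (Gr.mk_eq_zero_iff _ _ _).1 hg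
      exact CW.map_injective p HahnSeries.ofPowerSeries_injective (h.trans (map_zero _).symm)
    · intro f
      obtain ⟨⟨f, hf⟩, rfl⟩ := Gr.mk_surjective _ _ f
      obtain ⟨g, rfl⟩ := (CW.mem_fil_zero_iff p _).1 hf
      exact ⟨g, rfl⟩

theorem grIntegral_apply (g : CW p (PowerSeries k)) : grIntegral p k g = Gr.mk (CW.fil p k) 0
    ⟨CW.map p (HahnSeries.ofPowerSeries ℤ k) g, (CW.mem_fil_zero_iff p _).2 ⟨g, rfl⟩⟩ := rfl

theorem mem_fil_zero_iff (χ : H1 (Gsep (LaurentSeries k)) (QpZp p)) :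
    χ ∈ H1.fil p k 0 ↔ ∃ c, aswEquiv p _ (residueEquiv p k (0, c)) = χ := by
  obtain ⟨z, rfl⟩ := ((residueEquiv p k).trans (aswEquiv p _)).surjective χ
  simp only [AddEquiv.trans_apply]
  rw [aswEquiv_residueEquiv_mem_fil_iff]
  constructor
  · intro h
    refine ⟨z.2, ?_⟩
    congr 2
    exact Prod.ext (DFinsupp.ext fun n => ((h n).2 n.2.1).symm) rfl
  · rintro ⟨c, hc⟩
    rw [← (residueEquiv p k).injective ((aswEquiv p _).injective hc)]
    exact fun n => ⟨fun _ => zero_mem _, fun _ => rfl⟩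

/-- The isomorphism `CW(k) / (F - 1) CW(k) ≃ Gr_0(H¹)`. -/
def grUnramified : (CW p k ⧸ CW.asw p k) ≃+ Gr (H1.fil p k) 0 :=
  (AddEquiv.ofBijective
    ((((aswEquiv p (LaurentSeries k)).toAddMonoidHom.comp (residueEquiv p k).toAddMonoidHom).comp
      (AddMonoidHom.inr _ _)).codRestrict (H1.fil p k 0)
        fun c => (mem_fil_zero_iff p k _).2 ⟨c, rfl⟩) <| by
    constructor
    · intro c c' h
      have h1 : aswEquiv p (LaurentSeries k) (residueEquiv p k (0, c)) =
        aswEquiv p _ (residueEquiv p k (0, c')) := congrArg Subtype.val h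
      exact (Prod.ext_iff.1 ((residueEquiv p k).injective ((aswEquiv p _).injective h1))).2
    · rintro ⟨χ, hχ⟩
      obtain ⟨c, rfl⟩ := (mem_fil_zero_iff p k χ).1 hχ
      exact ⟨c, rfl⟩).trans (Gr.zeroEquiv (H1.fil p k)).symm

/-- Both sides are the character of `g`: the residue of `g` is the class of its constant term, and
`residueInv` recovers the class of `g` modulo `F - 1`. -/
theorem grProj_grIntegral (g : CW p (PowerSeries k)) : grProj p k 0 (grIntegral p k g) =
    grUnramified p k (QuotientAddGroup.mk (CW.map p (PowerSeries.constantCoeff (R := k)) g)) := by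
  rw [grIntegral_apply, grProj_mk, grUnramified, AddEquiv.trans_apply, AddEquiv.eq_symm_apply,
    Gr.zeroEquiv_mk]
  refine Subtype.ext ?_
  change aswHom p (LaurentSeries k) (CW.map p (HahnSeries.ofPowerSeries ℤ k) g) =
    aswEquiv p _ (residueInv p k
      (0, QuotientAddGroup.mk (CW.map p (PowerSeries.constantCoeff (R := k)) g)))
  rw [← residue_map_ofPowerSeries, residueInv_residue]
  rfl

end KatoGraded

/-! ### The decomposition of characters with values in `ℚ / ℤ` -/

section QZ

theorem QZ.proj_mk (p : ℕ) [Fact p.Prime] (q : ℚ) :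
    QZ.proj p (QuotientAddGroup.mk q) = QuotientAddGroup.mk (q : ℚ_[p]) := rfl

theorem QZ.exists_nsmul_eq_zero (x : QZ) : ∃ N : ℕ, 0 < N ∧ N • x = 0 := by
  obtain ⟨q, rfl⟩ := QuotientAddGroup.mk_surjective x
  refine ⟨q.den, q.den_pos, ?_⟩
  rw [← QuotientAddGroup.mk_nsmul, QuotientAddGroup.eq_zero_iff, nsmul_eq_mul, mul_comm,
    Rat.mul_den_eq_num]
  exact ⟨q.num, by simp⟩

/-- The order of the projection divides both `N` and a power of `l`, which are coprime. -/
theorem QZ.proj_eq_zero_of_nsmul {N : ℕ} {x : QZ} (hx : N • x = 0) (l : ℕ) [hl : Fact l.Prime]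
    (hN : ¬ l ∣ N) : QZ.proj l x = 0 := by
  obtain ⟨n, hn⟩ := QpZp.exists_pow_nsmul_eq_zero l (QZ.proj l x)
  have h1 : N • QZ.proj l x = 0 := by rw [← map_nsmul, hx, map_zero]
  rw [← AddMonoid.addOrderOf_eq_one_iff]
  exact Nat.eq_one_of_dvd_coprimes (((Nat.Prime.coprime_iff_not_dvd hl.out).2 hN).pow_left n)
    (addOrderOf_dvd_of_nsmul_eq_zero hn) (addOrderOf_dvd_of_nsmul_eq_zero h1)

/-- A rational number integral at every prime has denominator `1`. -/
theorem QZ.eq_zero_of_proj (x : QZ) (h : ∀ (l : ℕ) [Fact l.Prime], QZ.proj l x = 0) : x = 0 := by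
  obtain ⟨q, rfl⟩ := QuotientAddGroup.mk_surjective x
  have hden : q.den = 1 := by
    by_contra hne
    obtain ⟨l, hl, hdvd⟩ := Nat.exists_prime_and_dvd hne
    have : Fact l.Prime := ⟨hl⟩
    have h1 := h l
    rw [QZ.proj_mk, QpZp.mk_eq_zero_iff] at h1
    have h2 := PadicInt.isUnit_iff.1 (PadicInt.isUnit_den q h1)
    exact (PadicInt.norm_natCast_lt_one_iff.2 hdvd).ne h2
  rw [QuotientAddGroup.eq_zero_iff]
  exact ⟨q.num, by simpa using (Rat.den_eq_one_iff q).1 hden⟩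

theorem QZ.exists_proj_eq (l : ℕ) [hl : Fact l.Prime] (y : QpZp l) :
    ∃ x : QZ, QZ.proj l x = y ∧ ∃ n : ℕ, l ^ n • x = 0 := by
  obtain ⟨n, hn⟩ := QpZp.exists_pow_nsmul_eq_zero l y
  obtain ⟨a, rfl⟩ := QpZp.exists_int_of_pow_nsmul_eq_zero l n y hn
  refine ⟨QuotientAddGroup.mk ((a : ℚ) / (l : ℚ) ^ n), ?_, n, ?_⟩
  · rw [QZ.proj_mk]
    push_cast
    rfl
  · have h0 : (l : ℚ) ≠ 0 := by exact_mod_cast hl.out.ne_zero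
    rw [← QuotientAddGroup.mk_nsmul, QuotientAddGroup.eq_zero_iff, nsmul_eq_mul, Nat.cast_pow,
      mul_div_cancel₀ _ (pow_ne_zero n h0)]
    exact ⟨a, by simp⟩

theorem QZ.proj_eq_zero_of_ne {l l' n : ℕ} [hl : Fact l.Prime] [hl' : Fact l'.Prime] (h : l' ≠ l)
    {x : QZ} (hx : l ^ n • x = 0) : QZ.proj l' x = 0 :=
  QZ.proj_eq_zero_of_nsmul hx l' fun hd =>
    h ((Nat.prime_dvd_prime_iff_eq hl'.out hl.out).1 (hl'.out.dvd_of_dvd_pow hd))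

/-- The inclusion `ℚ_ℓ / ℤ_ℓ → ℚ / ℤ` of the `ℓ`-component. -/
def QZ.incl (l : ℕ) [hl : Fact l.Prime] : QpZp l →+ QZ :=
  AddMonoidHom.mk' (fun y => (QZ.exists_proj_eq l y).choose) fun y z => by
    obtain ⟨h1, n1, hn1⟩ := (QZ.exists_proj_eq l (y + z)).choose_spec
    obtain ⟨h2, n2, hn2⟩ := (QZ.exists_proj_eq l y).choose_spec
    obtain ⟨h3, n3, hn3⟩ := (QZ.exists_proj_eq l z).choose_spec
    -- Additivity of the chosen lifts: an element of `ℚ/ℤ` is determined by its projections, and an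
    -- `l`-power torsion lift projects to zero at every other prime.
    rw [← sub_eq_zero]
    refine QZ.eq_zero_of_proj _ fun l' hl' => ?_
    rw [map_sub, map_add]
    by_cases h : l' = l
    · subst h
      rw [h1, h2, h3, sub_self]
    · rw [QZ.proj_eq_zero_of_ne h hn1, QZ.proj_eq_zero_of_ne h hn2, QZ.proj_eq_zero_of_ne h hn3,
        add_zero, sub_zero]

theorem QZ.proj_incl (l : ℕ) [Fact l.Prime] (y : QpZp l) : QZ.proj l (QZ.incl l y) = y :=
  (QZ.exists_proj_eq l y).choose_spec.1

theorem QZ.proj_incl_of_ne {l l' : ℕ} [Fact l.Prime] [Fact l'.Prime] (h : l' ≠ l) (y : QpZp l) :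
    QZ.proj l' (QZ.incl l y) = 0 := by
  obtain ⟨n, hn⟩ := (QZ.exists_proj_eq l y).choose_spec.2
  exact QZ.proj_eq_zero_of_ne h hn

end QZ

/-! ### Primary components of continuous characters. -/

section Characters

variable (G : Type*) [Group G] [TopologicalSpace G]

theorem H1.map_proj_incl (l : ℕ) [Fact l.Prime] (χ : H1 G (QpZp l)) :
    H1.map G (QZ.proj l) (H1.map G (QZ.incl l) χ) = χ :=
  H1.ext fun _ => QZ.proj_incl l _

theorem H1.map_proj_incl_of_ne {l l' : ℕ} [Fact l.Prime] [Fact l'.Prime] (h : l' ≠ l)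
    (χ : H1 G (QpZp l)) : H1.map G (QZ.proj l') (H1.map G (QZ.incl l) χ) = 0 :=
  H1.ext fun _ => QZ.proj_incl_of_ne h _

variable {G} in
theorem H1.ext_proj {χ ψ : H1 G QZ}
    (h : ∀ (l : ℕ) [Fact l.Prime], H1.map G (QZ.proj l) χ = H1.map G (QZ.proj l) ψ) : χ = ψ := by
  refine H1.ext fun γ => ?_
  rw [← sub_eq_zero]
  refine QZ.eq_zero_of_proj _ fun l hl => ?_
  rw [map_sub, sub_eq_zero]
  exact DFunLike.congr_fun (congrArg Subtype.val (h l)) (Additive.ofMul γ)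

variable {G} in
theorem H1.exists_nsmul_eq_zero [CompactSpace G] (χ : H1 G QZ) :
    ∃ N : ℕ, 0 < N ∧ ∀ g, N • χ.1 (Additive.ofMul g) = 0 := by
  choose N hN0 hN using QZ.exists_nsmul_eq_zero
  refine ⟨∏ x ∈ (H1.finite_range χ).toFinset, N x, Finset.prod_pos fun x _ => hN0 x, fun g => ?_⟩
  obtain ⟨c, hc⟩ := Finset.dvd_prod_of_mem N
    ((H1.finite_range χ).mem_toFinset.2 ⟨g, rfl⟩ : χ.1 (Additive.ofMul g) ∈ _)
  rw [hc, mul_nsmul, hN, smul_zero]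

variable (p : ℕ)

theorem H1.proj_toAddMonoid (z : ⨁ l : PrimesNe p, H1 G (QpZp l)) (l : ℕ) [hl : Fact l.Prime] :
    H1.map G (QZ.proj l) (DirectSum.toAddMonoid (fun l : PrimesNe p => H1.map G (QZ.incl l)) z) =
      if h : l ≠ p then z ⟨l, hl.out, h⟩ else 0 := by
  induction z using DirectSum.induction_on with
  | zero =>
    rw [map_zero, map_zero]
    split_ifs <;> rfl
  | of l' χ =>
    rw [DirectSum.toAddMonoid_of]
    split_ifs with h
    · by_cases h' : l' = ⟨l, hl.out, h⟩
      · subst h'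
        rw [DirectSum.of_eq_same]
        exact H1.map_proj_incl G l χ
      · rw [DirectSum.of_eq_of_ne _ _ _ (Ne.symm h')]
        exact H1.map_proj_incl_of_ne G (fun h => h' (Subtype.ext h.symm)) χ
    · exact H1.map_proj_incl_of_ne G (fun h' => h fun h'' => l'.2.2 (h'.symm.trans h'')) χ
  | add x y hx hy =>
    rw [map_add, map_add, hx, hy]
    split_ifs
    · rfl
    · exact add_zero _

variable [hp : Fact p.Prime]

/-- The character of `G` with the given components. -/
def H1.ofComponents : (H1 G (QpZp p) × ⨁ l : PrimesNe p, H1 G (QpZp l)) →+ H1 G QZ :=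
  (H1.map G (QZ.incl p)).coprod (DirectSum.toAddMonoid fun l : PrimesNe p => H1.map G (QZ.incl l))

theorem H1.proj_ofComponents_self (w : H1 G (QpZp p) × ⨁ l : PrimesNe p, H1 G (QpZp l)) :
    H1.map G (QZ.proj p) (H1.ofComponents G p w) = w.1 := by
  rw [H1.ofComponents, AddMonoidHom.coprod_apply, map_add, H1.map_proj_incl, H1.proj_toAddMonoid,
    dif_neg (by simp), add_zero]

theorem H1.proj_ofComponents (w : H1 G (QpZp p) × ⨁ l : PrimesNe p, H1 G (QpZp l))
    (l : PrimesNe p) : H1.map G (QZ.proj l) (H1.ofComponents G p w) = w.2 l := by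
  rw [H1.ofComponents, AddMonoidHom.coprod_apply, map_add, H1.map_proj_incl_of_ne G l.2.2,
    H1.proj_toAddMonoid, dif_pos l.2.2, zero_add]

/-- By compactness a single `N > 0` kills all values of `χ`. The components at primes not dividing
`N` vanish, so the family of components has finite support and lies in the direct sum. -/
theorem H1.exists_components [CompactSpace G] (χ : H1 G QZ) :
    ∃ z : ⨁ l : PrimesNe p, H1 G (QpZp l),
      H1.ofComponents G p (H1.map G (QZ.proj p) χ, z) = χ := by
  obtain ⟨N, hN0, hN⟩ := H1.exists_nsmul_eq_zero χ
  refine ⟨DirectSum.mk _ (N.primeFactors.subtype fun l : ℕ => l.Prime ∧ l ≠ p)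
    fun l => H1.map G (QZ.proj l) χ, H1.ext_proj fun l hl => ?_⟩
  by_cases h : l = p
  · subst h
    exact H1.proj_ofComponents_self G l _
  · refine (H1.proj_ofComponents G p _ ⟨l, hl.out, h⟩).trans ?_
    by_cases h' : (⟨l, hl.out, h⟩ : PrimesNe p) ∈
        N.primeFactors.subtype fun l : ℕ => l.Prime ∧ l ≠ p
    · exact DirectSum.mk_apply_of_mem h'
    · refine (DirectSum.mk_apply_of_notMem h').trans (H1.ext fun γ => ?_)
      rw [Finset.mem_subtype, Nat.mem_primeFactors] at h'
      exact (QZ.proj_eq_zero_of_nsmul (hN γ) l fun hd => h' ⟨hl.out, hd, hN0.ne'⟩).symm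

variable {p} in
/-- The decomposition of the group of characters with `p`-component in a given subgroup. -/
def H1.comapEquiv [CompactSpace G] (F : AddSubgroup (H1 G (QpZp p))) :
    F.comap (H1.map G (QZ.proj p)) ≃+ (F × ⨁ l : PrimesNe p, H1 G (QpZp l)) :=
  (AddEquiv.ofBijective
    (((H1.ofComponents G p).comp (F.subtype.prodMap (AddMonoidHom.id _))).codRestrict
      (F.comap (H1.map G (QZ.proj p))) fun w => by
        rw [AddSubgroup.mem_comap, AddMonoidHom.comp_apply, H1.proj_ofComponents_self]
        exact w.1.2) <| by
    constructor
    · rintro ⟨a, z⟩ ⟨b, w⟩ h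
      have h1 : H1.ofComponents G p (a.1, z) = H1.ofComponents G p (b.1, w) :=
        congrArg Subtype.val h
      refine Prod.ext (Subtype.ext ?_) (DFinsupp.ext fun l => ?_)
      · have h2 := congrArg (H1.map G (QZ.proj p)) h1
        rwa [H1.proj_ofComponents_self, H1.proj_ofComponents_self] at h2
      · have h2 := congrArg (H1.map G (QZ.proj l)) h1
        rwa [H1.proj_ofComponents, H1.proj_ofComponents] at h2
    · rintro ⟨χ, hχ⟩
      obtain ⟨z, hz⟩ := H1.exists_components G p χ
      exact ⟨(⟨_, hχ⟩, z), Subtype.ext hz⟩).symm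

theorem H1.ofComponents_comapEquiv [CompactSpace G] (F : AddSubgroup (H1 G (QpZp p)))
    (χ : F.comap (H1.map G (QZ.proj p))) : H1.ofComponents G p
      (((H1.comapEquiv G F χ).1 : H1 G (QpZp p)), (H1.comapEquiv G F χ).2) = χ :=
  congrArg Subtype.val ((H1.comapEquiv G F).symm_apply_apply χ)

theorem H1.comapEquiv_fst [CompactSpace G] (F : AddSubgroup (H1 G (QpZp p)))
    (χ : F.comap (H1.map G (QZ.proj p))) :
    ((H1.comapEquiv G F χ).1 : H1 G (QpZp p)) = H1.map G (QZ.proj p) χ := by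
  conv_rhs => rw [← H1.ofComponents_comapEquiv G p F χ]
  rw [H1.proj_ofComponents_self]

theorem H1.comapEquiv_snd [CompactSpace G] (F : AddSubgroup (H1 G (QpZp p)))
    (χ : F.comap (H1.map G (QZ.proj p))) (l : PrimesNe p) :
    (H1.comapEquiv G F χ).2 l = H1.map G (QZ.proj l) χ := by
  conv_rhs => rw [← H1.ofComponents_comapEquiv G p F χ]
  rw [H1.proj_ofComponents]

end Characters

/-! ### Kato's filtration on characters with values in `ℚ/ℤ`. -/

section Final

variable (p : ℕ) [hp : Fact p.Prime] (k : Type*) [Field k] [CharP k p]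

/-- The projection on the `p`-component, on the steps of Kato's filtrations. -/
def filProj (d : ℕ) : H1.filQZ p k d →+ H1.fil p k d :=
  ((H1.map (Gsep (LaurentSeries k)) (QZ.proj p)).comp (H1.filQZ p k d).subtype).codRestrict _
    fun χ => χ.2

theorem filProj_surjective (d : ℕ) : Function.Surjective (filProj p k d) := by
  rintro ⟨χ, hχ⟩
  refine ⟨⟨H1.map _ (QZ.incl p) χ, ?_⟩, Subtype.ext (H1.map_proj_incl _ p χ)⟩
  rw [H1.filQZ, AddSubgroup.mem_comap, H1.map_proj_incl]
  exact hχ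

/-- The isomorphism `Gr_d(H¹(G, ℚ/ℤ)) ≃ Gr_d(H¹(G, ℚ_p/ℤ_p))` for `d > 0`. -/
def grProjEquiv (d : ℕ) : Gr (H1.filQZ p k) (d + 1) ≃+ Gr (H1.fil p k) (d + 1) :=
  quotientEquivOfKer ((Gr.mk (H1.fil p k) (d + 1)).comp (filProj p k (d + 1)))
    -- In positive degree the previous step is also an inverse image, so the kernel is right by
    -- definition. In degree zero the previous step is `⊥`, and the components prime to `p` survive.
    ((Gr.mk_surjective _ _).comp (filProj_surjective p k _)) _ fun χ => by
      rw [AddMonoidHom.comp_apply, Gr.mk_eq_zero_iff, AddSubgroup.mem_addSubgroupOf]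
      rfl

theorem grProjEquiv_mk (d : ℕ) (χ : H1.filQZ p k (d + 1)) :
    grProjEquiv p k d (Gr.mk _ _ χ) = Gr.mk _ _ (filProj p k (d + 1) χ) := rfl

/-- The decomposition of `Gr_0(H¹(G, ℚ/ℤ))`. -/
def grZeroComponents : Gr (H1.filQZ p k) 0 ≃+ (H1.fil p k 0 ×
    ⨁ l : PrimesNe p, H1 (Gsep (LaurentSeries k)) (QpZp l)) :=
  (Gr.zeroEquiv (H1.filQZ p k)).trans (H1.comapEquiv _ (H1.fil p k 0))

theorem grZeroComponents_mk (χ : H1.filQZ p k 0) :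
    grZeroComponents p k (Gr.mk _ 0 χ) = H1.comapEquiv _ (H1.fil p k 0) χ :=
  congrArg (H1.comapEquiv _ (H1.fil p k 0)) (Gr.zeroEquiv_mk (H1.filQZ p k) χ)

theorem grZeroComponents_mk_fst (χ : H1.filQZ p k 0) :
    ((grZeroComponents p k (Gr.mk _ 0 χ)).1 : H1 (Gsep (LaurentSeries k)) (QpZp p)) =
      H1.map _ (QZ.proj p) χ := by
  rw [grZeroComponents_mk]
  exact H1.comapEquiv_fst _ p _ χ

theorem grZeroComponents_mk_snd (χ : H1.filQZ p k 0) (l : PrimesNe p) :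
    (grZeroComponents p k (Gr.mk _ 0 χ)).2 l = H1.map _ (QZ.proj l) χ := by
  rw [grZeroComponents_mk]
  exact H1.comapEquiv_snd _ p _ χ l

end Final
end KatoSwan

end

open KatoSwan in
theorem theorem4 (p : ℕ) [Fact p.Prime] (k : Type*) [Field k] [CharP k p] :
    ∃ (δ : (KatoSwan.CW p (LaurentSeries k) ⧸ KatoSwan.CW.asw p (LaurentSeries k)) ≃+
          KatoSwan.H1 (KatoSwan.Gsep (LaurentSeries k)) (KatoSwan.QpZp p))
      (Ψ : ((⨁ _ : KatoSwan.Jp p, KatoSwan.CWt p k) ×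
            (KatoSwan.CW p k ⧸ KatoSwan.CW.asw p k)) ≃+
          (KatoSwan.CW p (LaurentSeries k) ⧸ KatoSwan.CW.asw p (LaurentSeries k)))
      (Proj : (d : ℕ) →
          KatoSwan.Gr (KatoSwan.CW.fil p k) d →+ KatoSwan.Gr (KatoSwan.H1.fil p k) d),
    -- Part 1: `δ` is induced by the Artin-Schreier-Witt morphism, and `Ψ` by the co-monomials
    -- and by the inclusion of `k` in `k((t))`.
    (∀ f χ, (f, χ) ∈ KatoSwan.aswGraph p (LaurentSeries k) ↔ δ (QuotientAddGroup.mk f) = χ) ∧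
    (∀ (n : KatoSwan.Jp p) (m : ℕ) (x : KatoSwan.W p m k),
      Ψ (DirectSum.of (fun _ : KatoSwan.Jp p => KatoSwan.CWt p k) n (KatoSwan.CWt.of p k m x), 0) =
        QuotientAddGroup.mk (KatoSwan.comonomial p k n m x)) ∧
    (∀ f₀ : KatoSwan.CW p k,
      Ψ (0, QuotientAddGroup.mk f₀) =
        QuotientAddGroup.mk (KatoSwan.CW.map p (HahnSeries.C : k →+* LaurentSeries k) f₀)) ∧
    -- Part 2: the filtration, in terms of `Fil_m(CW~(k)) ≅ W_m(k)`.
    (∀ m : ℕ, Function.Injective (KatoSwan.CWt.of p k m)) ∧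
    (∀ χ, χ ∈ KatoSwan.H1.fil p k 0 ↔ ∃ c, δ (Ψ (0, c)) = χ) ∧
    (∀ (d : ℕ), 1 ≤ d → ∀ z, δ (Ψ z) ∈ KatoSwan.H1.fil p k d ↔
      ∀ n : KatoSwan.Jp p,
        ((n : ℕ) ≤ d → z.1 n ∈ KatoSwan.CWt.fil p k (sSup {m : ℕ | n * p ^ m ≤ d})) ∧
        (d < (n : ℕ) → z.1 n = 0)) ∧
    -- Parts 2 and 3: the graded pieces and the projections `Proj d`.
    (∀ d, Function.Surjective (Proj d) ∧
      ∀ f : KatoSwan.CW.fil p k d, ∃ χ : KatoSwan.H1.fil p k d,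
        (χ : KatoSwan.H1 (KatoSwan.Gsep (LaurentSeries k)) (KatoSwan.QpZp p)) =
          δ (QuotientAddGroup.mk (f : KatoSwan.CW p (LaurentSeries k))) ∧
        Proj d (KatoSwan.Gr.mk _ d f) = KatoSwan.Gr.mk _ d χ) ∧
    (∀ d : ℕ, 0 < d →
      ∃ (a : KatoSwan.W p (padicValNat p d) k ≃+ KatoSwan.Gr (KatoSwan.CW.fil p k) d)
        (e : (KatoSwan.W p (padicValNat p d) k ⧸
            (nsmulAddMonoidHom (α := KatoSwan.W p (padicValNat p d) k) p).range) ≃+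
          KatoSwan.Gr (KatoSwan.H1.fil p k) d),
        (∀ x, ∃ f : KatoSwan.CW.fil p k d,
          (f : KatoSwan.CW p (LaurentSeries k)) =
            KatoSwan.comonomial p k (d / p ^ padicValNat p d) (padicValNat p d) x ∧
          a x = KatoSwan.Gr.mk _ d f) ∧
        ∀ x, Proj d (a x) = e (QuotientAddGroup.mk x)) ∧
    (∃ (a : KatoSwan.CW p (PowerSeries k) ≃+ KatoSwan.Gr (KatoSwan.CW.fil p k) 0)
        (e : (KatoSwan.CW p k ⧸ KatoSwan.CW.asw p k) ≃+ KatoSwan.Gr (KatoSwan.H1.fil p k) 0),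
        (∀ g, ∃ f : KatoSwan.CW.fil p k 0,
          (f : KatoSwan.CW p (LaurentSeries k)) =
            KatoSwan.CW.map p (HahnSeries.ofPowerSeries ℤ k) g ∧
          a g = KatoSwan.Gr.mk _ 0 f) ∧
        ∀ g, Proj 0 (a g) =
          e (QuotientAddGroup.mk (KatoSwan.CW.map p (PowerSeries.constantCoeff (R := k)) g))) ∧
    -- Part 4: the filtration on `H¹(G_E, ℚ/ℤ)` and its graded pieces.
    (∀ d : ℕ, ∃ e : KatoSwan.H1.filQZ p k d ≃+ (KatoSwan.H1.fil p k d ×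
          ⨁ l : KatoSwan.PrimesNe p,
            KatoSwan.H1 (KatoSwan.Gsep (LaurentSeries k)) (KatoSwan.QpZp l)),
      ∀ χ, ((e χ).1 : KatoSwan.H1 (KatoSwan.Gsep (LaurentSeries k)) (KatoSwan.QpZp p)) =
          KatoSwan.H1.map _ (KatoSwan.QZ.proj p) χ ∧
        ∀ l, (e χ).2 l = KatoSwan.H1.map _ (KatoSwan.QZ.proj l) χ) ∧
    (∀ d : ℕ, 0 < d →
      ∃ e : KatoSwan.Gr (KatoSwan.H1.filQZ p k) d ≃+ KatoSwan.Gr (KatoSwan.H1.fil p k) d,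
        ∀ χ : KatoSwan.H1.filQZ p k d, ∃ ψ : KatoSwan.H1.fil p k d,
          (ψ : KatoSwan.H1 (KatoSwan.Gsep (LaurentSeries k)) (KatoSwan.QpZp p)) =
            KatoSwan.H1.map _ (KatoSwan.QZ.proj p) χ ∧
          e (KatoSwan.Gr.mk _ d χ) = KatoSwan.Gr.mk _ d ψ) ∧
    (∃ e : KatoSwan.Gr (KatoSwan.H1.filQZ p k) 0 ≃+ (KatoSwan.H1.fil p k 0 ×
          ⨁ l : KatoSwan.PrimesNe p,
            KatoSwan.H1 (KatoSwan.Gsep (LaurentSeries k)) (KatoSwan.QpZp l)),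
      ∀ χ : KatoSwan.H1.filQZ p k 0,
        ((e (KatoSwan.Gr.mk _ 0 χ)).1 :
            KatoSwan.H1 (KatoSwan.Gsep (LaurentSeries k)) (KatoSwan.QpZp p)) =
          KatoSwan.H1.map _ (KatoSwan.QZ.proj p) χ ∧
        ∀ l, (e (KatoSwan.Gr.mk _ 0 χ)).2 l = KatoSwan.H1.map _ (KatoSwan.QZ.proj l) χ) := by
  refine ⟨aswEquiv p (LaurentSeries k), residueEquiv p k, grProj p k, mem_aswGraph_iff p,
    fun n m x => ?_, residueInv_mk p k, CWt.of_injective p k, mem_fil_zero_iff p k,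
    fun d _ z => aswEquiv_residueEquiv_mem_fil_iff p k d z, fun d => ?_, fun d hd => ?_, ?_,
    fun d => ?_, fun d hd => ?_, ?_⟩
  · rw [← comonomialHom_apply]
    exact residueInv_of p k n m x
  · exact ⟨grProj_surjective p k d, fun f => ⟨aswFil p k d f, rfl, grProj_mk p k d f⟩⟩
  · have hdvd : p ^ padicValNat p d ∣ d := pow_padicValNat_dvd
    have hmul : d / p ^ padicValNat p d * p ^ padicValNat p d = d := Nat.div_mul_cancel hdvd
    have hcop : (d / p ^ padicValNat p d).Coprime p := by
      refine ((Nat.Prime.coprime_iff_not_dvd Fact.out).2 fun h => ?_).symm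
      refine pow_succ_padicValNat_not_dvd (p := p) hd.ne' ?_
      rw [pow_succ']
      conv_rhs => rw [← hmul]
      exact Nat.mul_dvd_mul_right h _
    -- Only the factorisation `d = n pᵐ` with `n` prime to `p` matters from here on.
    generalize padicValNat p d = m at hmul hcop ⊢
    generalize d / p ^ m = n at hmul hcop ⊢
    obtain ⟨d, rfl⟩ := Nat.exists_eq_succ_of_ne_zero hd.ne'
    refine ⟨grComonomial p k hcop hmul.symm, grWittQuot p k hcop hmul.symm,
      fun x => ⟨_, comonomialHom_apply p n m x, grComonomial_apply p k hcop hmul.symm x⟩,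
      fun x => rfl⟩
  · exact ⟨grIntegral p k, grUnramified p k, fun g => ⟨_, rfl, grIntegral_apply p k g⟩,
      grProj_grIntegral p k⟩
  · exact ⟨H1.comapEquiv _ (H1.fil p k d), fun χ => ⟨H1.comapEquiv_fst _ p _ χ,
      H1.comapEquiv_snd _ p _ χ⟩⟩
  · obtain ⟨d, rfl⟩ := Nat.exists_eq_succ_of_ne_zero hd.ne'
    exact ⟨grProjEquiv p k d, fun χ => ⟨filProj p k (d + 1) χ, rfl, grProjEquiv_mk p k d χ⟩⟩
  · exact ⟨grZeroComponents p k, fun χ =>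
      ⟨grZeroComponents_mk_fst p k χ, grZeroComponents_mk_snd p k χ⟩⟩
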